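/- **Conventions.** Let $\Pi,F$ be real Hausdorff locally convex spaces with $\Pi$ finite dimensional, and let $Q\subseteq\Pi$ satisfy $Q\subseteq\overline{\operatorname{int}Q}$. For $f:Q\to F$ and $u_1,\dots,u_k\in\Pi$, the extended iterated directional derivative $\bar d(u_1,\dots,u_k)f$ is the function on $Q$ that equals the iterated directional derivative $d_{u_k}\cdots d_{u_1}f$ on $\operatorname{int}Q$ (required to exist there) and whose value at a point $x\in Q\setminus\operatorname{int}Q$ is the limit of these values as $v\to x$, $v\in\operatorname{int}Q$. For $i\in\{0,1,2,\dots,\infty\}$, $C^i(Q,F)$ is the space of continuous $f:Q\to F$ such that $\bar d(u_1,\dots,u_k)f$ exists and is continuous on $Q$ for all finite $k\le i$ and all $u_1,\dots,u_k\in\Pi$, with the coarsest topology making all the maps $f\mapsto\bar d(u_1,\dots,u_k)f$ continuous into $C(Q,F)$ with the compact-open topology. For real Hausdorff locally convex spaces $E,F$, a map $f$ from a subset $\Omega=\operatorname{dom}f$ of $E$ to $F$ is of Keller class $C^\infty_\Pi$ (where $\Pi$ is only a label) if $\Omega$ is open; for all $l\in\mathbb N_0$ and $x\in\Omega$ the iterated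 directional derivatives $d^lf(x)(u_1,\dots,u_l)=d_{u_l}\cdots d_{u_1}f(x)$ exist for all $u_1,\dots,u_l\in E$ and form a continuous $l$-linear map $E^l\to F$; and for all $l\in\mathbb N_0$, $x\in\Omega$ and every zero neighbourhood $W$ of $F$ there is a zero neighbourhood $U$ of $E$ such that for every $\varepsilon>0$ there is a zero neighbourhood $V$ of $E$ with $x+V\subseteq\Omega$ and $(d^lf(x+v)-d^lf(x))[U^l]\subseteq\varepsilon W$ for all $v\in V$. **Theorem 3.6.** Let $i\in\{0,1,2,\dots,\infty\}$, let $\Pi,\Pi_1,\Pi_2$ be finite-dimensional real Hausdorff locally convex spaces, let $Q\subseteq\Pi$ with $Q\subseteq\overline{\operatorname{int}Q}$, and let $O\subseteq Q\times\Pi_1$ be relatively open in $Q\times\Pi_1$ and such that the set $\{\eta\in Q:(\eta,\xi)\notin O\text{ for some }\xi\in\Pi_1\}$ is contained in a compact subset of $Q$. Let $E=C^\infty(O,\Pi_2)$, where $O$ is regarded as a subset of $\Pi\times\Pi_1$, and let $F_1=C^i(Q,\Pi_1)$ and $F_2=C^i(Q,\Pi_2)$. Let $f$ be the map from a subset of $E\times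 F_1$ to $F_2$ defined by $f(x,y)=x\circ[\mathrm{id},y]$, i.e. $f(x,y)(\eta)=x(\eta,y(\eta))$ for $\eta\in Q$, whose domain is the set of all $(x,y)\in E\times F_1$ such that $(\eta,y(\eta))\in O$ for all $\eta\in Q$ and the function $\eta\mapsto x(\eta,y(\eta))$ belongs to $F_2$. Then $f$ is of Keller class $C^\infty_\Pi$ (that is, smooth). -/

import Mathlib

open Set Filter Topology

noncomputable section

namespace Superposition

/-- A value singled out by a property `p` (which has at most one solution in all uses below): it is
defined iff `p` has a solution, and is then a solution. -/
def theOnly {α : Type*} (p : α → Prop) : Part α := ⟨∃ a, p a, fun h => h.choose⟩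

theorem mem_theOnly {α : Type*} {p : α → Prop} (hp : ∀ a b, p a → p b → a = b) {a : α} :
    a ∈ theOnly p ↔ p a := by
  constructor
  · rintro ⟨h, rfl⟩
    exact h.choose_spec
  · intro h
    exact ⟨⟨a, h⟩, hp _ _ (Exists.choose_spec ⟨a, h⟩) h⟩

/-! ### Directional derivatives of partially defined maps -/

section Variations

variable {E F : Type*} [AddCommGroup E] [Module ℝ E] [TopologicalSpace E]
  [AddCommGroup F] [Module ℝ F] [TopologicalSpace F]

/-- `y` is the limit of `t⁻¹ (f (x + t u) - f x)` as `t → 0`: here `f` is a partial map, `x` has to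
lie in its domain, `0` has to be a limit point of `{t ≠ 0 | x + t u ∈ dom f}`, and the limit is
taken over the `t` in this set. -/
def HasDirDeriv (f : E →. F) (u x : E) (y : F) : Prop :=
  ∃ b ∈ f x, (∃ᶠ t in 𝓝[≠] (0 : ℝ), (f (x + t • u)).Dom) ∧
    ∀ W ∈ 𝓝 y, ∀ᶠ t in 𝓝[≠] (0 : ℝ), ∀ a ∈ f (x + t • u), t⁻¹ • (a - b) ∈ W

/-- The directional derivative `d_u f`, a partial map defined where the limit exists. -/
def dirDeriv (f : E →. F) (u : E) : E →. F := fun x => theOnly (HasDirDeriv f u x)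

/-- The iterated directional derivative `d(u₁, …, u_k) f = d_{u_k} (⋯ (d_{u_1} f))`. Its value at
`x` is the `k`-th variation `δ^k f (x, u₁, …, u_k)`. -/
def iterDirDeriv (f : E →. F) : (k : ℕ) → (Fin k → E) → (E →. F)
  | 0, _ => f
  | k + 1, u => dirDeriv (iterDirDeriv f k (Fin.init u)) (u (Fin.last k))

theorem HasDirDeriv.unique [T2Space F] {f : E →. F} {u x : E} {y z : F}
    (hy : HasDirDeriv f u x y) (hz : HasDirDeriv f u x z) : y = z := by
  obtain ⟨b, hb, hfr, hy⟩ := hy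
  obtain ⟨b', hb', -, hz⟩ := hz
  obtain rfl := Part.mem_unique hb hb'
  by_contra hne
  obtain ⟨V, W, hV, hW, hyV, hzW, hd⟩ := t2_separation hne
  obtain ⟨t, hdom, h1, h2⟩ := (hfr.and_eventually
    ((hy V (hV.mem_nhds hyV)).and (hz W (hW.mem_nhds hzW)))).exists
  exact (Set.disjoint_left.1 hd) (h1 _ (Part.get_mem hdom)) (h2 _ (Part.get_mem hdom))

theorem mem_dirDeriv [T2Space F] {f : E →. F} {u x : E} {y : F} :
    y ∈ dirDeriv f u x ↔ HasDirDeriv f u x y :=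
  mem_theOnly fun _ _ => HasDirDeriv.unique

theorem dom_of_dom_dirDeriv {f : E →. F} {u x : E} (h : (dirDeriv f u x).Dom) : (f x).Dom := by
  obtain ⟨y, b, hb, -⟩ := h
  exact Part.dom_iff_mem.2 ⟨b, hb⟩

theorem eventually_line_mem [IsTopologicalAddGroup E] [ContinuousSMul ℝ E] {A : Set E}
    (hA : IsOpen A) {x : E} (hx : x ∈ A) (u : E) : ∀ᶠ t in 𝓝[≠] (0 : ℝ), x + t • u ∈ A := by
  have hc : Continuous fun t : ℝ => x + t • u := by fun_prop
  have : ∀ᶠ t in 𝓝 (0 : ℝ), x + t • u ∈ A :=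
    hc.continuousAt.eventually (hA.mem_nhds (by simpa using hx))
  exact this.filter_mono nhdsWithin_le_nhds

theorem iterDirDeriv_linear [IsTopologicalAddGroup E] [ContinuousSMul ℝ E]
    [IsTopologicalAddGroup F] [ContinuousSMul ℝ F] [T2Space F] {A : Set E} (hA : IsOpen A) (c : ℝ)
    {f g h : E →. F} (hfgh : ∀ x ∈ A, ∀ a ∈ f x, ∀ b ∈ g x, c • a + b ∈ h x) :
    ∀ (k : ℕ) (u : Fin k → E), (∀ x ∈ A, (iterDirDeriv f k u x).Dom) →
      (∀ x ∈ A, (iterDirDeriv g k u x).Dom) →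
      ∀ x ∈ A, ∀ a ∈ iterDirDeriv f k u x, ∀ b ∈ iterDirDeriv g k u x,
        c • a + b ∈ iterDirDeriv h k u x := by
  intro k
  induction k with
  | zero => intro u _ _; exact hfgh
  | succ k ih =>
    intro u hf hg x hx a ha b hb
    have hf' : ∀ x ∈ A, (iterDirDeriv f k (Fin.init u) x).Dom := fun x hx =>
      dom_of_dom_dirDeriv (hf x hx)
    have hg' : ∀ x ∈ A, (iterDirDeriv g k (Fin.init u) x).Dom := fun x hx =>
      dom_of_dom_dirDeriv (hg x hx)
    have key := ih (Fin.init u) hf' hg'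
    obtain ⟨a₀, ha₀, -, ha⟩ := mem_dirDeriv.1 ha
    obtain ⟨b₀, hb₀, -, hb⟩ := mem_dirDeriv.1 hb
    refine mem_dirDeriv.2 ⟨c • a₀ + b₀, key x hx a₀ ha₀ b₀ hb₀, ?_, ?_⟩
    · refine Eventually.frequently ?_
      filter_upwards [eventually_line_mem hA hx (u (Fin.last k))] with t ht
      exact Part.dom_iff_mem.2 ⟨_, key _ ht _ (Part.get_mem (hf' _ ht)) _ (Part.get_mem (hg' _ ht))⟩
    · intro W hW
      have hc : Continuous fun p : F × F => c • p.1 + p.2 := by fun_prop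
      have hW' : (fun p : F × F => c • p.1 + p.2) ⁻¹' W ∈ 𝓝 (a, b) :=
        hc.continuousAt.preimage_mem_nhds hW
      rw [nhds_prod_eq, mem_prod_iff] at hW'
      obtain ⟨V₁, hV₁, V₂, hV₂, hV⟩ := hW'
      filter_upwards [ha V₁ hV₁, hb V₂ hV₂, eventually_line_mem hA hx (u (Fin.last k))]
        with t h1 h2 ht e he
      have m1 := Part.get_mem (hf' _ ht)
      have m2 := Part.get_mem (hg' _ ht)
      obtain rfl := Part.mem_unique he (key _ ht _ m1 _ m2)
      have := hV (Set.mk_mem_prod (h1 _ m1) (h2 _ m2))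
      simp only [Set.mem_preimage] at this
      convert this using 1
      module

end Variations

/-! ### The spaces `C^i(Q, F)` -/

section Spaces

variable {P F : Type*} [AddCommGroup P] [Module ℝ P] [TopologicalSpace P]
  [AddCommGroup F] [Module ℝ F] [TopologicalSpace F]

/-- A function on a subset `Q` of `P`, as a partial map with domain `Q`. -/
def toPartial {Q : Set P} (f : Q → F) : P →. F := fun x => ⟨x ∈ Q, fun h => f ⟨x, h⟩⟩

theorem mem_toPartial {Q : Set P} {f : Q → F} {x : P} {y : F} :
    y ∈ toPartial f x ↔ ∃ h : x ∈ Q, f ⟨x, h⟩ = y := Iff.rfl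

/-- `g : Q → F` is the extended iterated directional derivative of `f : Q → F` in the directions
`u₁, …, u_k`: at interior points of `Q` the iterated directional derivative of `f` exists and equals
`g`, and at the remaining points of `Q` the value of `g` is the limit of these interior values. -/
def IsExtDeriv {Q : Set P} (f : Q → F) {k : ℕ} (u : Fin k → P) (g : Q → F) : Prop :=
  (∀ x : Q, (x : P) ∈ interior Q → g x ∈ iterDirDeriv (toPartial f) k u x) ∧
  ∀ x : Q, (x : P) ∉ interior Q → Tendsto g (𝓝[{v : Q | (v : P) ∈ interior Q}] x) (𝓝 (g x))

theorem IsExtDeriv.linear [IsTopologicalAddGroup P] [ContinuousSMul ℝ P]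
    [IsTopologicalAddGroup F] [ContinuousSMul ℝ F] [T2Space F] {Q : Set P} {f f' g g' : Q → F}
    {k : ℕ} {u : Fin k → P} (c : ℝ) (h : IsExtDeriv f u g) (h' : IsExtDeriv f' u g') :
    IsExtDeriv (c • f + f') u (c • g + g') := by
  refine ⟨fun x hx => ?_, fun x hx => ((h.2 x hx).const_smul c).add (h'.2 x hx)⟩
  refine iterDirDeriv_linear (f := toPartial f) (g := toPartial f') isOpen_interior c ?_ k u
    ?_ ?_ x hx _ (h.1 x hx) _ (h'.1 x hx)
  · rintro x - a ⟨hx, rfl⟩ b ⟨-, rfl⟩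
    exact ⟨hx, rfl⟩
  · intro y hy
    exact Part.dom_iff_mem.2 ⟨_, h.1 ⟨y, interior_subset hy⟩ hy⟩
  · intro y hy
    exact Part.dom_iff_mem.2 ⟨_, h'.1 ⟨y, interior_subset hy⟩ hy⟩

theorem IsExtDeriv.zero [IsTopologicalAddGroup P] [ContinuousSMul ℝ P] [T2Space F]
    (Q : Set P) {k : ℕ} (u : Fin k → P) : IsExtDeriv (0 : Q → F) u 0 := by
  refine ⟨fun x hx => ?_, fun x _ => tendsto_const_nhds⟩
  change (0 : F) ∈ _
  have : ∀ (k : ℕ) (u : Fin k → P) (x : P), x ∈ interior Q →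
      (0 : F) ∈ iterDirDeriv (toPartial (0 : Q → F)) k u x := by
    intro k
    induction k with
    | zero => intro u x hx; exact ⟨interior_subset hx, rfl⟩
    | succ k ih =>
      intro u x hx
      have hev := eventually_line_mem (isOpen_interior (s := Q)) hx (u (Fin.last k))
      refine mem_dirDeriv.2 ⟨0, ih _ x hx, ?_, ?_⟩
      · exact (hev.mono fun t ht => Part.dom_iff_mem.2 ⟨0, ih _ _ ht⟩).frequently
      · intro W hW
        filter_upwards [hev] with t ht a ha
        obtain rfl := Part.mem_unique ha (ih _ _ ht)
        simpa using mem_of_mem_nhds hW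
  exact this k u x hx

/-- The condition imposed on the domains of the function spaces: every point of `Q` is a limit of
interior points of `Q`. -/
def IsRegular (Q : Set P) : Prop := Q ⊆ closure (interior Q)

theorem IsRegular.dense {Q : Set P} (hQ : IsRegular Q) : Dense {v : Q | (v : P) ∈ interior Q} := by
  intro x
  rw [closure_subtype]
  refine closure_mono (fun y hy => ?_) (hQ x.2)
  exact ⟨⟨y, interior_subset hy⟩, hy, rfl⟩

theorem IsExtDeriv.unique [T2Space F] {Q : Set P} (hQ : IsRegular Q) {f : Q → F} {k : ℕ}
    {u : Fin k → P} {g g' : C(Q, F)} (h : IsExtDeriv f u g) (h' : IsExtDeriv f u g') : g = g' := by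
  have : (g : Q → F) = g' := Continuous.ext_on hQ.dense g.continuous g'.continuous
    fun x hx => Part.mem_unique (h.1 x hx) (h'.1 x hx)
  exact DFunLike.coe_injective this

/-- A relatively open subset of a cylinder over a regular set is regular. -/
theorem IsRegular.of_relOpen {P₁ : Type*} [TopologicalSpace P₁] [AddCommGroup P₁] [Module ℝ P₁]
    {Q : Set P} (hQ : IsRegular Q) {O : Set (P × P₁)}
    (hO : ∃ U : Set (P × P₁), IsOpen U ∧ O = U ∩ Q ×ˢ univ) : IsRegular O := by
  obtain ⟨U, hU, rfl⟩ := hO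
  intro p hp
  have h : p ∈ closure (interior Q ×ˢ (univ : Set P₁)) := by
    rw [closure_prod_eq]
    exact ⟨hQ hp.2.1, by simp⟩
  have := hU.inter_closure ⟨hp.1, h⟩
  rwa [interior_inter, hU.interior_eq, interior_prod_eq, interior_univ]

variable [IsTopologicalAddGroup P] [ContinuousSMul ℝ P]
  [IsTopologicalAddGroup F] [ContinuousSMul ℝ F] [T2Space F]

/-- The continuous functions on `Q` all of whose extended iterated directional derivatives of order
at most `i` exist and are continuous on `Q`. -/
def ckSubmodule (i : ℕ∞) (Q : Set P) (F : Type*) [AddCommGroup F] [Module ℝ F] [TopologicalSpace F]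
    [IsTopologicalAddGroup F] [ContinuousSMul ℝ F] [T2Space F] : Submodule ℝ C(Q, F) where
  carrier := {f | ∀ k : ℕ, (k : ℕ∞) ≤ i → ∀ u : Fin k → P, ∃ g : C(Q, F), IsExtDeriv f u g}
  zero_mem' := fun _ _ u => ⟨0, IsExtDeriv.zero Q u⟩
  add_mem' := by
    intro f f' hf hf' k hk u
    obtain ⟨g, hg⟩ := hf k hk u
    obtain ⟨g', hg'⟩ := hf' k hk u
    exact ⟨g + g', by simpa using hg.linear 1 hg'⟩
  smul_mem' := by
    intro c f hf k hk u
    obtain ⟨g, hg⟩ := hf k hk u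
    exact ⟨c • g, by simpa using hg.linear c (IsExtDeriv.zero Q u)⟩

/-- The vector space `C^i(Q, F)`; its topology is defined below. The proof `hQ` is recorded in the
type because the topology is only meaningful for regular `Q`. -/
def CkSpace (i : ℕ∞) (Q : Set P) (_hQ : IsRegular Q) (F : Type*) [AddCommGroup F] [Module ℝ F]
    [TopologicalSpace F] [IsTopologicalAddGroup F] [ContinuousSMul ℝ F] [T2Space F] : Type _ :=
  {f : C(Q, F) // f ∈ ckSubmodule i Q F}

namespace CkSpace

variable {i : ℕ∞} {Q : Set P} {hQ : IsRegular Q}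

instance : AddCommGroup (CkSpace i Q hQ F) := inferInstanceAs (AddCommGroup (ckSubmodule i Q F))

instance : Module ℝ (CkSpace i Q hQ F) := inferInstanceAs (Module ℝ (ckSubmodule i Q F))

/-- The underlying continuous function. -/
def toFun (f : CkSpace i Q hQ F) : C(Q, F) := f.1

instance : CoeFun (CkSpace i Q hQ F) fun _ => Q → F := ⟨fun f => f.toFun⟩

/-- The continuous function `d̄(u₁, …, u_k) f` on `Q`, for `f` in `C^i(Q, F)` and `k ≤ i`. -/
def extDeriv (k : {k : ℕ // (k : ℕ∞) ≤ i}) (u : Fin k → P) (f : CkSpace i Q hQ F) : C(Q, F) :=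
  (f.2 k k.2 u).choose

theorem isExtDeriv_extDeriv (k : {k : ℕ // (k : ℕ∞) ≤ i}) (u : Fin k → P)
    (f : CkSpace i Q hQ F) : IsExtDeriv f u (extDeriv k u f) := (f.2 k k.2 u).choose_spec

theorem extDeriv_linear (k : {k : ℕ // (k : ℕ∞) ≤ i}) (u : Fin k → P) (c : ℝ)
    (f g : CkSpace i Q hQ F) : extDeriv k u (c • f + g) = c • extDeriv k u f + extDeriv k u g :=
  (isExtDeriv_extDeriv k u (c • f + g)).unique hQ
    ((isExtDeriv_extDeriv k u f).linear c (isExtDeriv_extDeriv k u g))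

theorem extDeriv_zero (h : ((0 : ℕ) : ℕ∞) ≤ i) (u : Fin 0 → P) (f : CkSpace i Q hQ F) :
    extDeriv ⟨0, h⟩ u f = f.toFun := by
  refine (isExtDeriv_extDeriv ⟨0, h⟩ u f).unique hQ ⟨fun x _ => ⟨x.2, rfl⟩, fun x _ => ?_⟩
  exact f.toFun.continuous.continuousAt.continuousWithinAt

/-- All the extended iterated directional derivatives of order at most `i` together. -/
def jet : CkSpace i Q hQ F →ₗ[ℝ] ((k : {k : ℕ // (k : ℕ∞) ≤ i}) → (Fin k → P) → C(Q, F)) where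
  toFun f := fun k u => extDeriv k u f
  map_add' f g := by
    funext k u
    simpa using extDeriv_linear k u 1 f g
  map_smul' c f := by
    funext k u
    have h0 : extDeriv k u (0 : CkSpace i Q hQ F) = 0 := by
      simpa using extDeriv_linear k u 1 (0 : CkSpace i Q hQ F) 0
    simpa [h0] using extDeriv_linear k u c f 0

/-- The topology of `C^i(Q, F)`: the coarsest one making all the maps `f ↦ d̄(u₁, …, u_k) f`,
`k ≤ i`, continuous into `C(Q, F)` with the compact-open topology. -/
instance : TopologicalSpace (CkSpace i Q hQ F) := TopologicalSpace.induced jet inferInstance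

instance : IsTopologicalAddGroup (CkSpace i Q hQ F) :=
  topologicalAddGroup_induced (jet (hQ := hQ))

instance : ContinuousSMul ℝ (CkSpace i Q hQ F) := continuousSMul_induced (jet (hQ := hQ))

instance [LocallyConvexSpace ℝ F] : LocallyConvexSpace ℝ (CkSpace i Q hQ F) :=
  LocallyConvexSpace.induced (jet (hQ := hQ))

theorem jet_injective : Function.Injective (jet : CkSpace i Q hQ F →ₗ[ℝ] _) := by
  intro f g h
  have h0 : ((0 : ℕ) : ℕ∞) ≤ i := by simp
  have := congrFun (congrFun h ⟨0, h0⟩) Fin.elim0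
  change extDeriv _ _ f = extDeriv _ _ g at this
  rw [extDeriv_zero, extDeriv_zero] at this
  exact Subtype.ext this

instance : T2Space (CkSpace i Q hQ F) :=
  T2Space.of_injective_continuous jet_injective continuous_induced_dom

end CkSpace

end Spaces

/-! ### The Keller classes `C_Π^k` -/

open scoped Pointwise in
/-- The Keller class `C_Π^n` of partial maps between real Hausdorff locally convex spaces. The map
has an open domain; for every `l ≤ n` and `x` in the domain, the variation
`(u₁, …, u_l) ↦ δ^l f (x, u₁, …, u_l)` is defined on all of `E^l` and is a continuous multilinear
map `D l x`; and `x ↦ D l x` is continuous in the sense of the convergence structure `Π`. -/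
def KellerCPi {E F : Type*} [AddCommGroup E] [Module ℝ E] [TopologicalSpace E]
    [IsTopologicalAddGroup E] [ContinuousSMul ℝ E] [LocallyConvexSpace ℝ E] [T2Space E]
    [AddCommGroup F] [Module ℝ F] [TopologicalSpace F]
    [IsTopologicalAddGroup F] [ContinuousSMul ℝ F] [LocallyConvexSpace ℝ F] [T2Space F]
    (n : ℕ∞) (f : E →. F) : Prop :=
  IsOpen f.Dom ∧
  ∃ D : (l : ℕ) → E → ContinuousMultilinearMap ℝ (fun _ : Fin l => E) F,
    (∀ l : ℕ, (l : ℕ∞) ≤ n → ∀ x ∈ f.Dom, ∀ u : Fin l → E, D l x u ∈ iterDirDeriv f l u x) ∧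
    ∀ l : ℕ, (l : ℕ∞) ≤ n → ∀ x ∈ f.Dom, ∀ W ∈ 𝓝 (0 : F), ∃ U ∈ 𝓝 (0 : E),
      ∀ ε : ℝ, 0 < ε → ∃ V ∈ 𝓝 (0 : E), ∀ v ∈ V, x + v ∈ f.Dom ∧
        ∀ u : Fin l → E, (∀ j, u j ∈ U) → D l (x + v) u - D l x u ∈ ε • W

/-! ### The superposition map -/

section Superposition

variable {P P₁ P₂ : Type*}
  [AddCommGroup P] [Module ℝ P] [TopologicalSpace P] [IsTopologicalAddGroup P] [ContinuousSMul ℝ P]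
  [AddCommGroup P₁] [Module ℝ P₁] [TopologicalSpace P₁] [IsTopologicalAddGroup P₁]
  [ContinuousSMul ℝ P₁] [T2Space P₁]
  [AddCommGroup P₂] [Module ℝ P₂] [TopologicalSpace P₂] [IsTopologicalAddGroup P₂]
  [ContinuousSMul ℝ P₂] [T2Space P₂]

/-- The partial map `(x, y) ↦ x ∘ [id, y] = (η ↦ x (η, y η))` from `C^∞(O, P₂) × C^i(Q, P₁)` to
`C^i(Q, P₂)`. Its domain consists of the `(x, y)` for which the graph of `y` lies in `O` and the
function `η ↦ x (η, y η)` belongs to `C^i(Q, P₂)`. -/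
def superposition (i : ℕ∞) {Q : Set P} (hQ : IsRegular Q) {O : Set (P × P₁)} (hO : IsRegular O) :
    CkSpace (⊤ : ℕ∞) O hO P₂ × CkSpace i Q hQ P₁ →. CkSpace i Q hQ P₂ :=
  fun p => theOnly fun z => ∀ η : Q, ∃ h : ((η : P), p.2 η) ∈ O, z η = p.1 ⟨((η : P), p.2 η), h⟩

end Superposition

end Superposition

end

/-! At a fixed point η, the product and chain rules differentiate x(η, y(η)) with respect to (x, y):
in the direction (v, w) the result is v(η, y(η)) + d_{(0, w(η))}x(η, y(η)). Hence all derivatives,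
in η as well as in (x, y), are sums of terms (d̄(w)x_j) ∘ [id, y] multiplied by coordinates of
functions d̄(p)y_j, where each (x_j, y_j) is the base point or one of the directions. `DiffExpr`
encodes such sums; `spatial` and `vary` are the two formal derivatives. As x is C^∞ and `vary` never
raises the order of differentiation of y (`DiffExpr.OrderLE.vary`), every formal variation lies in
C^i(Q, P₂). In particular the composite belongs to C^i as soon as the graph of y lies in O, and this
is an open condition on y because only the fibres over a compact set are incomplete
(`isOpen_setOf_graph_subset`).

Three facts make the formal calculus genuine. Composition with a graph is continuous
(`continuous_comp_graphMap`), so expressions depend continuously on base point and directions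
(`DiffExpr.continuous_eval`). Differentiation along fibres is legitimate even over points of Q
outside its interior (`hasDerivAt_der_fibre`), so `vary` is the true derivative at every η. Finally,
the two formal derivatives commute after evaluation (`DiffExpr.eval_spatialIter_vary`), because
derivatives of x are symmetric.

The mean value inequality, uniform over compact sets, then shows that difference quotients converge
in C^i (`tendsto_superpositionDeriv`). Combined with linearity in the newest direction it also gives
the Π-continuity of the variations (`superpositionDeriv_uniform`). -/

set_option linter.unusedSectionVars false

open Set Filter Topology

noncomputable section

namespace Superposition

/-! The derivatives of `(x, y) ↦ x ∘ [id, y]` with respect to the argument and to `(x, y)` are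
described by formal expressions. Their values depend continuously on `(x, y)` and the directions,
so the mean value theorem yields the smoothness of the superposition map. Finite-dimensional spaces
are normed for this purpose. -/

/-! ### Calculus along segments -/

section Calculus

variable {V F : Type*} [NormedAddCommGroup V] [NormedSpace ℝ V]
  [NormedAddCommGroup F] [NormedSpace ℝ F]

/-- A function whose derivative along a segment stays close to a constant is close to being affine
along this segment. -/
theorem norm_sub_sub_smul_le {φ φ' : ℝ → F} {c : F} {ε T : ℝ}
    (hφ : ∀ t, |t| ≤ |T| → HasDerivAt φ (φ' t) t) (hε : ∀ t, |t| ≤ |T| → ‖φ' t - c‖ ≤ ε) :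
    ‖φ T - φ 0 - T • c‖ ≤ ε * |T| := by
  have key := Convex.norm_image_sub_le_of_norm_hasDerivWithin_le (f := fun t => φ t - t • c)
    (f' := fun t => φ' t - c) (s := Icc (-|T|) |T|) (x := 0) (y := T) (C := ε)
    (fun t ht => by
      have h1 := (hφ t (abs_le.2 ht)).sub ((hasDerivAt_id t).smul_const c)
      simpa using! h1.hasDerivWithinAt) (fun t ht => hε t (abs_le.2 ht)) (convex_Icc _ _)
    (by simp) (abs_le.1 le_rfl)
  simp only [zero_smul, sub_zero, Real.norm_eq_abs] at key
  rwa [sub_right_comm] at key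

theorem hasDerivAt_line_shift {V : Type*} [AddCommGroup V] [Module ℝ V] {g : V → F} {x w : V}
    {t : ℝ} {d : F}
    (h : HasDerivAt (fun s : ℝ => g (x + t • w + s • w)) d 0) :
    HasDerivAt (fun s : ℝ => g (x + s • w)) d t := by
  have h' : HasDerivAt (fun s : ℝ => g (x + t • w + s • w)) d (t - t) := by simpa using h
  refine (h'.comp_sub_const t t).congr_of_eventuallyEq (Eventually.of_forall fun s => ?_)
  simp only
  congr 1
  module

/-- A function with continuous partial derivatives is differentiable. -/
theorem hasFDerivAt_of_partial {ι : Type*} [Fintype ι] [FiniteDimensional ℝ V]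
    (e : Module.Basis ι ℝ V) {g : V → F} {g' : ι → V → F} {a : V}
    (hd : ∀ j, ∀ᶠ x in 𝓝 a, HasDerivAt (fun t : ℝ => g (x + t • e j)) (g' j x) 0)
    (hc : ∀ j, ContinuousAt (g' j) a) :
    HasFDerivAt g (∑ j, (LinearMap.toContinuousLinearMap (e.coord j)).smulRight (g' j a)) a := by
  classical
  -- The path from a to a + h is walked one coordinate at a time; each leg is nearly affine by
  -- continuity of one partial derivative.
  have main : ∀ s : Finset ι, (fun h : V => g (a + ∑ j ∈ s, e.coord j h • e j) - g a
      - ∑ j ∈ s, e.coord j h • g' j a) =o[𝓝 0] fun h => h := by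
    intro s
    induction s using Finset.induction_on with
    | empty => simp
    | insert k s hk ih =>
      have step : (fun h : V => g (a + ∑ j ∈ s, e.coord j h • e j + e.coord k h • e k)
          - g (a + ∑ j ∈ s, e.coord j h • e j) - e.coord k h • g' k a) =o[𝓝 0] fun h => h := by
        have hO : (fun h : V => e.coord k h) =O[𝓝 0] fun h => h :=
          (LinearMap.toContinuousLinearMap (e.coord k)).isBigO_id _
        refine Asymptotics.IsLittleO.trans_isBigO ?_ hO
        rw [Asymptotics.isLittleO_iff]
        intro ε hε
        obtain ⟨δ, hδ, hball⟩ := Metric.eventually_nhds_iff.1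
          ((hd k).and (Metric.tendsto_nhds.1 (hc k) ε hε))
        have c1 : Continuous fun h : V => a + ∑ j ∈ s, e.coord j h • e j := by
          have : ∀ j, Continuous fun h : V => e.coord j h := fun j =>
            (LinearMap.toContinuousLinearMap (e.coord j)).continuous
          fun_prop
        have c2 : Continuous fun h : V => e.coord k h :=
          (LinearMap.toContinuousLinearMap (e.coord k)).continuous
        have e1 : ∀ᶠ h in 𝓝 (0 : V), dist (a + ∑ j ∈ s, e.coord j h • e j) a < δ / 2 := by
          refine c1.continuousAt.eventually (p := fun y => dist y a < δ / 2) ?_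
          exact Metric.eventually_nhds_iff.2 ⟨δ / 2, half_pos hδ, fun y hy => by simpa using hy⟩
        have e2 : ∀ᶠ h in 𝓝 (0 : V), |e.coord k h| * ‖e k‖ < δ / 2 := by
          have : Continuous fun h : V => |e.coord k h| * ‖e k‖ := by fun_prop
          refine this.continuousAt.eventually (p := fun y => y < δ / 2) ?_
          exact eventually_lt_nhds (by simpa using half_pos hδ)
        filter_upwards [e1, e2] with h h1 h2
        set x := a + ∑ j ∈ s, e.coord j h • e j
        have hin : ∀ t : ℝ, |t| ≤ |e.coord k h| → dist (x + t • e k) a < δ := by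
          intro t ht
          calc dist (x + t • e k) a ≤ dist (x + t • e k) x + dist x a := dist_triangle _ _ _
            _ < δ / 2 + δ / 2 := by
                refine add_lt_add (lt_of_le_of_lt ?_ h2) h1
                rw [dist_eq_norm, add_sub_cancel_left, norm_smul]
                exact mul_le_mul_of_nonneg_right ht (norm_nonneg _)
            _ = δ := add_halves δ
        have := norm_sub_sub_smul_le (φ := fun t => g (x + t • e k))
          (φ' := fun t => g' k (x + t • e k)) (c := g' k a) (ε := ε) (T := e.coord k h)
          (fun t ht => hasDerivAt_line_shift (hball (hin t ht)).1)
          (fun t ht => by rw [← dist_eq_norm]; exact (hball (hin t ht)).2.le)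
        simpa using! this
      refine (ih.add step).congr_left fun h => ?_
      rw [Finset.sum_insert hk, Finset.sum_insert hk]
      rw [show a + (e.coord k h • e k + ∑ j ∈ s, e.coord j h • e j)
        = a + ∑ j ∈ s, e.coord j h • e j + e.coord k h • e k by abel]
      abel
  rw [hasFDerivAt_iff_isLittleO_nhds_zero]
  refine (main Finset.univ).congr_left fun h => ?_
  have hsum : ∑ j, e.coord j h • e j = h := by simpa only [Module.Basis.coord_apply] using e.sum_repr h
  rw [hsum]
  simp

end Calculus

/-! ### Linearity and symmetry of extended derivatives -/

section ExtendedDerivatives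

variable {P F : Type*} [NormedAddCommGroup P] [NormedSpace ℝ P]
  [NormedAddCommGroup F] [NormedSpace ℝ F]

/-- For a partial map defined on an open set, directional derivatives are derivatives along lines of
any representing total map. -/
theorem hasDirDeriv_iff_hasDerivAt {f : P →. F} {G : P → F} {A : Set P} (hA : IsOpen A)
    (hG : ∀ x ∈ A, G x ∈ f x) {x : P} (hx : x ∈ A) (u : P) (y : F) :
    HasDirDeriv f u x y ↔ HasDerivAt (fun t : ℝ => G (x + t • u)) y 0 := by
  have hev := eventually_line_mem hA hx u
  rw [hasDerivAt_iff_tendsto_slope_zero]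
  simp only [zero_add, zero_smul, add_zero]
  constructor
  · rintro ⟨b, hb, -, hlim⟩
    obtain rfl := Part.mem_unique hb (hG x hx)
    intro W hW
    rw [mem_map]
    filter_upwards [hlim W hW, hev] with t ht hm
    exact ht _ (hG _ hm)
  · intro h
    refine ⟨G x, hG x hx, (hev.mono fun t ht => Part.dom_iff_mem.2 ⟨_, hG _ ht⟩).frequently, ?_⟩
    intro W hW
    filter_upwards [h hW, hev] with t ht hm a ha
    obtain rfl := Part.mem_unique ha (hG _ hm)
    exact ht

open Classical in
/-- The extension by zero of a function on a subset. -/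
def extZero {α β : Type*} [Zero β] {Q : Set α} (g : Q → β) (x : α) : β :=
  if h : x ∈ Q then g ⟨x, h⟩ else 0

theorem extZero_of_mem {α β : Type*} [Zero β] {Q : Set α} (g : Q → β) {x : α} (h : x ∈ Q) :
    extZero g x = g ⟨x, h⟩ := dif_pos h

theorem continuousAt_extZero {α β : Type*} [TopologicalSpace α] [TopologicalSpace β] [Zero β]
    {Q : Set α} (g : C(Q, β)) {x : α} (h : x ∈ interior Q) : ContinuousAt (extZero g) x := by
  have h1 : ContinuousOn (extZero g) Q := by
    rw [continuousOn_iff_continuous_domRestrict]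
    refine g.continuous.congr fun y => ?_
    simp [extZero_of_mem g y.2]
  exact h1.continuousAt (mem_interior_iff_mem_nhds.1 h)

theorem hasDerivAt_add_smul_of_hasFDerivAt {g : P → F} {L : P →L[ℝ] F} {x : P}
    (h : HasFDerivAt g L x) (q : P) : HasDerivAt (fun t : ℝ => g (x + t • q)) (L q) 0 := by
  have h2 : HasDerivAt (fun t : ℝ => x + t • q) q 0 := by
    simpa using ((hasDerivAt_id (0 : ℝ)).smul_const q).const_add x
  have h3 : HasFDerivAt g L (x + (0 : ℝ) • q) := by simpa using h
  exact h3.comp_hasDerivAt (0 : ℝ) h2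

/-- Transfers identities obtained by calculus in the interior to all of Q, by density and
continuity. -/
theorem continuousMap_eq_of_eq_interior {P F : Type*} [TopologicalSpace P]
    [AddCommGroup P] [Module ℝ P] [TopologicalSpace F] [T2Space F] {Q : Set P}
    {g g' : C(Q, F)} (hQ : IsRegular Q)
    (h : ∀ x : Q, (x : P) ∈ interior Q → g x = g' x) : g = g' :=
  DFunLike.coe_injective (Continuous.ext_on hQ.dense g.continuous g'.continuous h)

namespace CkSpace

variable {i : ℕ∞} {Q : Set P} {hQ : IsRegular Q}

open Classical in
/-- The operator `f ↦ d̄(u₁, …, u_k) f`, with value `0` for `k > i`. -/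
def der (k : ℕ) (u : Fin k → P) : CkSpace i Q hQ F →L[ℝ] C(Q, F) :=
  if h : (k : ℕ∞) ≤ i then
    { toLinearMap := (LinearMap.proj u).comp ((LinearMap.proj ⟨k, h⟩).comp jet)
      cont := by
        have h1 : Continuous (jet : CkSpace i Q hQ F →ₗ[ℝ] _) := continuous_induced_dom
        exact continuous_pi_iff.1 (continuous_pi_iff.1 h1 ⟨k, h⟩) u }
  else 0

theorem der_eq {k : ℕ} (h : (k : ℕ∞) ≤ i) (u : Fin k → P) (f : CkSpace i Q hQ F) :
    der k u f = extDeriv ⟨k, h⟩ u f := by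
  rw [der, dif_pos h]
  rfl

theorem der_zero (u : Fin 0 → P) (f : CkSpace i Q hQ F) : der 0 u f = f.toFun := by
  have h : ((0 : ℕ) : ℕ∞) ≤ i := by simp
  rw [der_eq h, extDeriv_zero]

theorem isExtDeriv_der {k : ℕ} (h : (k : ℕ∞) ≤ i) (u : Fin k → P) (f : CkSpace i Q hQ F) :
    IsExtDeriv f u (der k u f) := by
  rw [der_eq h]
  exact isExtDeriv_extDeriv ⟨k, h⟩ u f

theorem hasDerivAt_der {k : ℕ} (h : ((k + 1 : ℕ) : ℕ∞) ≤ i) (u : Fin k → P) (q : P)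
    (f : CkSpace i Q hQ F) {x : P} (hx : x ∈ interior Q) :
    HasDerivAt (fun t : ℝ => extZero (der k u f) (x + t • q))
      (extZero (der (k + 1) (Fin.snoc u q : Fin (k + 1) → P) f) x) 0 := by
  have hk : (k : ℕ∞) ≤ i := le_trans (by exact_mod_cast Nat.le_succ k) h
  have h1 := (isExtDeriv_der h (Fin.snoc u q : Fin (k + 1) → P) f).1 ⟨x, interior_subset hx⟩ hx
  rw [iterDirDeriv, Fin.init_snoc, Fin.snoc_last, mem_dirDeriv] at h1
  rw [extZero_of_mem _ (interior_subset hx)]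
  refine (hasDirDeriv_iff_hasDerivAt isOpen_interior (fun z hz => ?_) hx q _).1 h1
  rw [extZero_of_mem _ (interior_subset hz)]
  exact (isExtDeriv_der hk u f).1 ⟨z, interior_subset hz⟩ hz

theorem hasDerivAt_line_der {k : ℕ} (h : ((k + 1 : ℕ) : ℕ∞) ≤ i) (u : Fin k → P) (q : P)
    (f : CkSpace i Q hQ F) {x : P} {t : ℝ} (hx : x + t • q ∈ interior Q) :
    HasDerivAt (fun t : ℝ => extZero (der k u f) (x + t • q))
      (extZero (der (k + 1) (Fin.snoc u q : Fin (k + 1) → P) f) (x + t • q)) t :=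
  hasDerivAt_line_shift (g := extZero (der k u f)) (hasDerivAt_der h u q f hx)

section FiniteDimensional

variable [FiniteDimensional ℝ P]

/-- The differential of `der k u f` as a continuous linear map. -/
def grad (k : ℕ) (u : Fin k → P) (f : CkSpace i Q hQ F) (x : P) : P →L[ℝ] F :=
  ∑ j, (LinearMap.toContinuousLinearMap ((Module.finBasis ℝ P).coord j)).smulRight
    (extZero (der (k + 1) (Fin.snoc u (Module.finBasis ℝ P j) : Fin (k + 1) → P) f) x)

theorem hasFDerivAt_der {k : ℕ} (h : ((k + 1 : ℕ) : ℕ∞) ≤ i) (u : Fin k → P)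
    (f : CkSpace i Q hQ F) {x : P} (hx : x ∈ interior Q) :
    HasFDerivAt (extZero (der k u f)) (grad k u f x) x := by
  refine hasFDerivAt_of_partial (Module.finBasis ℝ P)
    (g' := fun j => extZero (der (k + 1) (Fin.snoc u (Module.finBasis ℝ P j) : Fin (k + 1) → P) f))
    (fun j => ?_) (fun j => continuousAt_extZero _ hx)
  filter_upwards [isOpen_interior.mem_nhds hx] with z hz
  exact hasDerivAt_der h u _ f hz

theorem grad_apply {k : ℕ} (h : ((k + 1 : ℕ) : ℕ∞) ≤ i) (u : Fin k → P)
    (f : CkSpace i Q hQ F) {x : P} (hx : x ∈ interior Q) (q : P) :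
    grad k u f x q = extZero (der (k + 1) (Fin.snoc u q : Fin (k + 1) → P) f) x :=
  (hasDerivAt_add_smul_of_hasFDerivAt (hasFDerivAt_der h u f hx) q).unique (hasDerivAt_der h u q f hx)

/-- Continuity of the partial derivatives makes `der k u f` Fréchet differentiable in the interior,
so its directional derivatives are values of a linear map there; density does the rest. -/
theorem der_snoc_linear {k : ℕ} (h : ((k + 1 : ℕ) : ℕ∞) ≤ i) (u : Fin k → P)
    (f : CkSpace i Q hQ F) (c : ℝ) (p q : P) :
    der (k + 1) (Fin.snoc u (c • p + q) : Fin (k + 1) → P) f =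
      c • der (k + 1) (Fin.snoc u p : Fin (k + 1) → P) f
        + der (k + 1) (Fin.snoc u q : Fin (k + 1) → P) f := by
  refine continuousMap_eq_of_eq_interior hQ fun x hx => ?_
  have := grad_apply h u f hx
  rw [ContinuousMap.add_apply, ContinuousMap.smul_apply]
  simp only [extZero_of_mem _ x.2] at this
  rw [← this, ← this, ← this, map_add, map_smul]

theorem der_snoc_comm {k : ℕ} (h : ((k + 2 : ℕ) : ℕ∞) ≤ i) (u : Fin k → P)
    (f : CkSpace i Q hQ F) (p q : P) :
    der (k + 2) (Fin.snoc (Fin.snoc u p : Fin (k + 1) → P) q : Fin (k + 2) → P) f =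
      der (k + 2) (Fin.snoc (Fin.snoc u q : Fin (k + 1) → P) p : Fin (k + 2) → P) f := by
  have hk : ((k + 1 : ℕ) : ℕ∞) ≤ i := le_trans (by exact_mod_cast Nat.le_succ (k + 1)) h
  refine continuousMap_eq_of_eq_interior hQ fun x hx => ?_
  have hnear : ∀ᶠ y in 𝓝 (x : P), y ∈ interior Q := isOpen_interior.mem_nhds hx
  have h1 : ∀ᶠ y in 𝓝 (x : P), HasFDerivAt (extZero (der k u f)) (grad k u f y) y :=
    hnear.mono fun y hy => hasFDerivAt_der hk u f hy
  -- The gradient is a finite sum of fixed functionals times extended derivatives of order k + 1,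
  -- each differentiable since k + 2 ≤ i. Symmetry of the second Fréchet derivative then applies.
  obtain ⟨f'', hf''⟩ : ∃ f'', HasFDerivAt (grad k u f) f'' (x : P) := by
    have hj := fun j => ((ContinuousLinearMap.smulRightL ℝ P F (LinearMap.toContinuousLinearMap
      ((Module.finBasis ℝ P).coord j))).hasFDerivAt).comp (x : P)
        (hasFDerivAt_der h (Fin.snoc u (Module.finBasis ℝ P j) : Fin (k + 1) → P) f hx)
    exact ⟨_, HasFDerivAt.fun_sum (u := Finset.univ) fun j _ => hj j⟩
  have key : ∀ a b : P, f'' b a = der (k + 2)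
      (Fin.snoc (Fin.snoc u a : Fin (k + 1) → P) b : Fin (k + 2) → P) f x := by
    intro a b
    have h2 : HasFDerivAt (fun y => grad k u f y a)
        ((ContinuousLinearMap.apply ℝ F a).comp f'') (x : P) :=
      (ContinuousLinearMap.apply ℝ F a).hasFDerivAt.comp (x : P) hf''
    have h3 := (hasFDerivAt_der h (Fin.snoc u a : Fin (k + 1) → P) f hx).congr_of_eventuallyEq
      (hnear.mono fun y hy => grad_apply hk u f hy a)
    have h4 := congrArg (fun L : P →L[ℝ] F => L b) (h2.unique h3)
    simp only [ContinuousLinearMap.comp_apply, ContinuousLinearMap.apply_apply] at h4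
    rw [h4, grad_apply h _ f hx, extZero_of_mem _ x.2]
  rw [← key, ← key, second_derivative_symmetric_of_eventually h1 hf'']

end FiniteDimensional

end CkSpace

end ExtendedDerivatives

section

/-! ### The compact-open topology -/

section CompactOpen

variable {X Y Z : Type*} [TopologicalSpace X] [TopologicalSpace Y] [TopologicalSpace Z]

/-- Continuity into a space of continuous functions is joint continuity over compact sets. -/
theorem continuous_iff_uncurry_compact [T2Space Y] {f : X → C(Y, Z)} :
    Continuous f ↔ ∀ K : Set Y, IsCompact K → Continuous fun p : X × K => f p.1 p.2 := by
  constructor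
  · intro hf K hK
    have : CompactSpace K := isCompact_iff_compactSpace.1 hK
    have h1 : Continuous fun p : X × K => ((f p.1).restrict K : C(K, Z)) :=
      (ContinuousMap.continuous_restrict K).comp (hf.comp continuous_fst)
    exact h1.eval continuous_snd
  · intro h
    rw [ContinuousMap.compactOpen_eq_iInf_induced]
    refine continuous_iInf_rng.2 fun K => continuous_iInf_rng.2 fun hK =>
      continuous_induced_rng.2 ?_
    exact ContinuousMap.continuous_of_continuous_uncurry _ (h K hK)

theorem eventually_norm_sub_lt {E : Type*} [NormedAddCommGroup E] {f : X → C(Y, E)} {x₀ : X}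
    (hf : ContinuousAt f x₀) {K : Set Y} (hK : IsCompact K) {ε : ℝ} (hε : 0 < ε) :
    ∀ᶠ x in 𝓝 x₀, ∀ y ∈ K, ‖f x y - f x₀ y‖ < ε := by
  have := ContinuousMap.tendsto_iff_forall_isCompact_tendstoUniformlyOn.1 hf K hK
  filter_upwards [Metric.tendstoUniformlyOn_iff.1 this ε hε] with x hx y hy
  rw [← dist_eq_norm, dist_comm]
  exact hx y hy

end CompactOpen

variable {P P₁ P₂ : Type*}
  [NormedAddCommGroup P] [NormedSpace ℝ P]
  [NormedAddCommGroup P₁] [NormedSpace ℝ P₁]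
  [NormedAddCommGroup P₂] [NormedSpace ℝ P₂]

/-! ### Relatively open subsets of a cylinder -/

section Cylinder

variable {Q : Set P} {O : Set (P × P₁)}

/-- `O` is relatively open in the cylinder `Q × P₁`. -/
def RelOpen (Q : Set P) (O : Set (P × P₁)) : Prop :=
  ∃ U : Set (P × P₁), IsOpen U ∧ O = U ∩ Q ×ˢ univ

theorem RelOpen.mem_interior (hO : RelOpen Q O) {p : P × P₁} (hp : p ∈ O)
    (h : p.1 ∈ interior Q) : p ∈ interior O := by
  obtain ⟨U, hU, rfl⟩ := hO
  rw [interior_inter, hU.interior_eq, interior_prod_eq, interior_univ]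
  exact ⟨hp.1, h, mem_univ _⟩

/-- The function `η ↦ g (η, y η)`. -/
def graphMap (y : C(Q, P₁)) (hy : ∀ η : Q, ((η : P), y η) ∈ O) : C(Q, O) :=
  ⟨fun η => ⟨((η : P), y η), hy η⟩, by fun_prop⟩

/-- Evaluation on C(O, Z) is jointly continuous when O is locally compact, which may fail for
general Q. Over a compact K only the part of O above K matters, and this part is locally closed in a
finite-dimensional space, hence locally compact. -/
theorem continuous_comp_graphMap [FiniteDimensional ℝ P] [FiniteDimensional ℝ P₁]
    {Z : Type*} [TopologicalSpace Z] (hO : RelOpen Q O) :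
    Continuous fun q : C(O, Z) × {y : C(Q, P₁) // ∀ η : Q, ((η : P), y η) ∈ O} =>
      q.1.comp (graphMap q.2.1 q.2.2) := by
  have : ProperSpace P := FiniteDimensional.proper ℝ P
  have : ProperSpace P₁ := FiniteDimensional.proper ℝ P₁
  obtain ⟨U, hU, hOU⟩ := hO
  refine continuous_iff_uncurry_compact.2 fun K hK => ?_
  set OK : Set (P × P₁) := U ∩ (Subtype.val '' K) ×ˢ univ
  have hlc : LocallyCompactSpace OK :=
    (hU.isLocallyClosed.inter ((hK.image continuous_subtype_val).isClosed.prod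
      isClosed_univ).isLocallyClosed).locallyCompactSpace
  have hsub : OK ⊆ O := by
    rw [hOU]
    exact inter_subset_inter_right _ (prod_mono (Subtype.coe_image_subset Q K) le_rfl)
  let incl : C(OK, O) := ⟨Set.inclusion hsub, continuous_inclusion hsub⟩
  have hy := continuous_iff_uncurry_compact.1
    (continuous_id (X := C(Q, P₁))) K hK
  have hy' : Continuous fun p : (C(O, Z) × {y : C(Q, P₁) // ∀ η : Q, ((η : P), y η) ∈ O}) × K =>
      p.1.2.1 (p.2 : Q) :=
    hy.comp (f := fun p : (C(O, Z) × {y : C(Q, P₁) // ∀ η : Q, ((η : P), y η) ∈ O}) × K =>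
      (p.1.2.1, p.2)) (by fun_prop)
  have hg : Continuous fun p : (C(O, Z) × {y : C(Q, P₁) // ∀ η : Q, ((η : P), y η) ∈ O}) × K =>
      p.1.1.comp incl := (ContinuousMap.continuous_precomp incl).comp (by fun_prop)
  have hpt : Continuous fun p : (C(O, Z) × {y : C(Q, P₁) // ∀ η : Q, ((η : P), y η) ∈ O}) × K =>
      (⟨(((p.2 : Q) : P), p.1.2.1 (p.2 : Q)), by
        have := hOU.le (p.1.2.2 (p.2 : Q))
        exact ⟨this.1, mem_image_of_mem _ p.2.2, mem_univ _⟩⟩ : OK) :=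
    Continuous.subtype_mk ((by fun_prop : Continuous fun p : (C(O, Z) ×
      {y : C(Q, P₁) // ∀ η : Q, ((η : P), y η) ∈ O}) × K => ((p.2 : Q) : P)).prodMk hy') _
  exact hg.eval hpt

/-- Outside K the fibres of O are complete and impose no condition. Over K the condition says that a
compact set is mapped into the open set U, which is open in the compact-open topology. -/
theorem isOpen_setOf_graph_subset (hO : RelOpen Q O)
    (hhole : ∃ K : Set P, IsCompact K ∧ K ⊆ Q ∧ Prod.fst '' (Q ×ˢ univ \ O) ⊆ K) :
    IsOpen {y : C(Q, P₁) | ∀ η : Q, ((η : P), y η) ∈ O} := by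
  obtain ⟨U, hU, hOU⟩ := hO
  obtain ⟨K, hK, hKQ, hsub⟩ := hhole
  have hK' : IsCompact (Subtype.val ⁻¹' K : Set Q) :=
    Topology.IsInducing.subtypeVal.isCompact_preimage_iff (by simpa using hKQ) |>.2 hK
  have hc : Continuous fun y : C(Q, P₁) =>
      (⟨fun η => ((η : P), y η), by fun_prop⟩ : C(Q, P × P₁)) := by
    refine continuous_iff_uncurry_compact.2 fun L hL => ?_
    exact (by fun_prop : Continuous fun p : C(Q, P₁) × L => ((p.2 : Q) : P)).prodMk
      (continuous_iff_uncurry_compact.1 (continuous_id (X := C(Q, P₁))) L hL)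
  convert (ContinuousMap.isOpen_setOfPred_mapsTo hK' hU).preimage hc using 1
  ext y
  simp only [mem_ofPred_eq, mem_preimage]
  constructor
  · intro h η _
    have := h η
    rw [hOU] at this
    exact this.1
  · intro h η
    by_cases hη : (η : P) ∈ K
    · rw [hOU]
      exact ⟨h hη, η.2, mem_univ _⟩
    · by_contra hne
      exact hη (hsub ⟨((η : P), y η), ⟨⟨η.2, mem_univ _⟩, hne⟩, rfl⟩)

/-- Extended derivatives are differentiable along the fibres of the cylinder, also over the points
of `Q` outside of its interior. -/
theorem hasDerivAt_der_fibre {i : ℕ∞} {hO' : IsRegular O} (hQ : IsRegular Q) (hO : RelOpen Q O)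
    {k : ℕ} (hk : ((k + 1 : ℕ) : ℕ∞) ≤ i) (w : Fin k → P × P₁) (x : CkSpace i O hO' P₂)
    {η : P} {ξ : P₁} (h : (η, ξ) ∈ O) (b : P₁) :
    HasDerivAt (fun t : ℝ => extZero (CkSpace.der k w x) (η, ξ + t • b))
      (extZero (CkSpace.der (k + 1) (Fin.snoc w ((0 : P), b) : Fin (k + 1) → P × P₁) x) (η, ξ))
      0 := by
  set g := extZero (CkSpace.der k w x)
  set g' := extZero (CkSpace.der (k + 1) (Fin.snoc w ((0 : P), b) : Fin (k + 1) → P × P₁) x)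
  have cont : ∀ f : C(O, P₂), ContinuousOn (extZero f) O := fun f => by
    rw [continuousOn_iff_continuous_domRestrict]
    refine f.continuous.congr fun y => ?_
    simp [extZero_of_mem f y.2]
  rw [hasDerivAt_iff_isLittleO_nhds_zero, Asymptotics.isLittleO_iff]
  intro ε hε
  obtain ⟨δ, hδ, hclose⟩ := Metric.continuousWithinAt_iff.1
    (cont _ (η, ξ) h : ContinuousWithinAt g' _ _) ε hε
  obtain ⟨U, hU, hOU⟩ := id hO
  have hηξ := h
  rw [hOU] at hηξ
  obtain ⟨δ', hδ', hball⟩ := Metric.isOpen_iff.1 hU _ hηξ.1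
  -- δ controls the variation of g', and δ' keeps the segments inside O.
  set r := min δ δ'
  have hr : 0 < r := lt_min hδ hδ'
  have ev : ∀ᶠ t in 𝓝 (0 : ℝ), ‖t • b‖ < r := by
    have : Continuous fun t : ℝ => ‖t • b‖ := by fun_prop
    refine this.continuousAt.eventually (p := fun y => y < r) (eventually_lt_nhds (by simpa using hr))
  filter_upwards [ev] with t ht
  have hin : ∀ s : ℝ, |s| ≤ |t| → ∀ η' : P, dist η' η < r → η' ∈ Q →
      (η', ξ + s • b) ∈ O ∧ dist (η', ξ + s • b) (η, ξ) < r := by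
    intro s hs η' hη' hQ'
    have hd : dist (η', ξ + s • b) (η, ξ) < r := by
      rw [Prod.dist_eq]
      refine max_lt hη' ?_
      simp only
      rw [dist_eq_norm, add_sub_cancel_left]
      refine lt_of_le_of_lt ?_ ht
      rw [norm_smul, norm_smul]
      exact mul_le_mul_of_nonneg_right hs (norm_nonneg _)
    refine ⟨?_, hd⟩
    rw [hOU]
    exact ⟨hball (hd.trans_le (min_le_right _ _)), hQ', mem_univ _⟩
  have hηQ : η ∈ Q := hηξ.2.1
  -- Over interior points the segment lies in the interior of O, where g' is the derivative. The
  -- bound is uniform in η', so it survives the limit η' → η, which exists through interior points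
  -- by regularity of Q.
  have interiorBound : ∀ η' ∈ interior Q, dist η' η < r →
      ‖g (η', ξ + t • b) - g (η', ξ) - t • g' (η, ξ)‖ ≤ ε * |t| := by
    intro η' hη' hd
    have hline : ∀ s : ℝ, ((η', ξ) : P × P₁) + s • ((0 : P), b) = (η', ξ + s • b) := fun s => by
      simp
    have := norm_sub_sub_smul_le (φ := fun s : ℝ => g (((η', ξ) : P × P₁) + s • ((0 : P), b)))
      (φ' := fun s => g' (((η', ξ) : P × P₁) + s • ((0 : P), b))) (c := g' (η, ξ)) (ε := ε) (T := t)
      (fun s hs => by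
        refine CkSpace.hasDerivAt_line_der hk w ((0 : P), b) x ?_
        rw [hline]
        exact hO.mem_interior (hin s hs η' hd (interior_subset hη')).1 hη')
      (fun s hs => by
        rw [hline, ← dist_eq_norm]
        have := hin s hs η' hd (interior_subset hη')
        exact (hclose this.1 (this.2.trans_le (min_le_left _ _))).le)
    simpa [hline] using this
  have hne : (𝓝[interior Q ∩ Metric.ball η r] η).NeBot := by
    rw [← mem_closure_iff_nhdsWithin_neBot, inter_comm]
    exact Metric.isOpen_ball.inter_closure ⟨Metric.mem_ball_self hr, hQ hηQ⟩
  have lim : ∀ s : ℝ, |s| ≤ |t| → Tendsto (fun η' => g (η', ξ + s • b))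
      (𝓝[interior Q ∩ Metric.ball η r] η) (𝓝 (g (η, ξ + s • b))) := by
    intro s hs
    have h1 : Tendsto (fun η' : P => (η', ξ + s • b)) (𝓝[interior Q ∩ Metric.ball η r] η)
        (𝓝[O] (η, ξ + s • b)) := by
      refine tendsto_nhdsWithin_iff.2 ⟨?_, ?_⟩
      · exact ((Continuous.prodMk_left (ξ + s • b)).tendsto η).mono_left nhdsWithin_le_nhds
      · filter_upwards [self_mem_nhdsWithin] with η' hη'
        exact (hin s hs η' hη'.2 (interior_subset hη'.1)).1
    exact (cont _ _ (hin s hs η (by simpa using hr) hηQ).1 :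
      ContinuousWithinAt g _ _).tendsto.comp h1
  have l0 := lim 0 (by simp)
  simp only [zero_smul, add_zero] at l0
  have := le_of_tendsto (((lim t le_rfl).sub l0).sub_const (t • g' (η, ξ))).norm
    (by filter_upwards [self_mem_nhdsWithin] with η' hη' using interiorBound η' hη'.1 hη'.2)
  simpa using this

end Cylinder

end

section

variable {P P₁ P₂ : Type*}
  [NormedAddCommGroup P] [NormedSpace ℝ P]
  [NormedAddCommGroup P₁] [NormedSpace ℝ P₁] [FiniteDimensional ℝ P₁]
  [NormedAddCommGroup P₂] [NormedSpace ℝ P₂]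

/-! ### Formal derivatives of the superposition map -/

variable (P P₁) in
/-- Expressions for the derivatives of `x ∘ [id, y]` with respect to the argument and to `(x, y)`.
The index `none` stands for the base point `(x, y)`, and `some j` for the `j`-th direction. -/
inductive DiffExpr : Type _
  | comp (j : Option ℕ) (k : ℕ) (w : Fin k → P × P₁) : DiffExpr
  | mul (j : Option ℕ) (ℓ : P₁ →L[ℝ] ℝ) (k : ℕ) (p : Fin k → P) (T : DiffExpr) : DiffExpr
  | add (S T : DiffExpr) : DiffExpr
  | sum (S : Fin (Module.finrank ℝ P₁) → DiffExpr) : DiffExpr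

variable (P₁) in
/-- The coordinate functionals of a finite-dimensional space. -/
def coordL (e : Fin (Module.finrank ℝ P₁)) : P₁ →L[ℝ] ℝ :=
  LinearMap.toContinuousLinearMap ((Module.finBasis ℝ P₁).coord e)

theorem sum_coordL_smul (b : P₁) : ∑ e, coordL P₁ e b • Module.finBasis ℝ P₁ e = b := by
  exact (Module.finBasis ℝ P₁).sum_repr b

variable (P) in
/-- The `e`-th basis vector of the second factor. -/
def fibreBasis (e : Fin (Module.finrank ℝ P₁)) : P × P₁ := (0, Module.finBasis ℝ P₁ e)

namespace DiffExpr

/-- The formal derivative with respect to the argument, in the direction `q`. -/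
def spatial (q : P) : DiffExpr P P₁ → DiffExpr P P₁
  | comp j k w => add (comp j (k + 1) (Fin.snoc w (q, 0)))
      (sum fun e => mul none (coordL P₁ e) 1 (Fin.snoc Fin.elim0 q)
        (comp j (k + 1) (Fin.snoc w (fibreBasis P e))))
  | mul j ℓ k p T => add (mul j ℓ (k + 1) (Fin.snoc p q) T) (mul j ℓ k p (spatial q T))
  | add S T => add (spatial q S) (spatial q T)
  | sum S => sum fun e => spatial q (S e)

/-- The formal derivative with respect to the base point, in the `r`-th direction. -/
def vary (r : ℕ) : DiffExpr P P₁ → DiffExpr P P₁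
  -- Here x and the graph both vary. In the next case the function being composed is a fixed
  -- direction, so only the motion of the graph contributes.
  | comp none k w => add (comp (some r) k w)
      (sum fun e => mul (some r) (coordL P₁ e) 0 Fin.elim0
        (comp none (k + 1) (Fin.snoc w (fibreBasis P e))))
  | comp (some j) k w => sum fun e => mul (some r) (coordL P₁ e) 0 Fin.elim0
        (comp (some j) (k + 1) (Fin.snoc w (fibreBasis P e)))
  | mul none ℓ k p T => add (mul (some r) ℓ k p T) (mul none ℓ k p (vary r T))
  | mul (some j) ℓ k p T => mul (some j) ℓ k p (vary r T)
  | add S T => add (vary r S) (vary r T)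
  | sum S => sum fun e => vary r (S e)

/-- Derivatives of order at most `m` of the inner function occur. -/
def OrderLE (m : ℕ) : DiffExpr P P₁ → Prop
  | comp _ _ _ => True
  | mul _ _ k _ T => k ≤ m ∧ OrderLE m T
  | add S T => OrderLE m S ∧ OrderLE m T
  | sum S => ∀ e, OrderLE m (S e)

/-- Only the directions with indices smaller than `r` occur. -/
def Below (r : ℕ) : DiffExpr P P₁ → Prop
  | comp j _ _ => ∀ n ∈ j, n < r
  | mul j _ _ _ T => (∀ n ∈ j, n < r) ∧ Below r T
  | add S T => Below r S ∧ Below r T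
  | sum S => ∀ e, Below r (S e)

theorem OrderLE.mono {m m' : ℕ} (h : m ≤ m') {T : DiffExpr P P₁} (hT : T.OrderLE m) :
    T.OrderLE m' := by
  induction T with
  | comp => trivial
  | mul j ℓ k p T ih => exact ⟨hT.1.trans h, ih hT.2⟩
  | add S T ihS ihT => exact ⟨ihS hT.1, ihT hT.2⟩
  | sum S ih => exact fun e => ih e (hT e)

theorem OrderLE.spatial {m : ℕ} (q : P) {T : DiffExpr P P₁} (hT : T.OrderLE m) :
    (T.spatial q).OrderLE (m + 1) := by
  induction T with
  | comp => exact ⟨trivial, fun e => ⟨by omega, trivial⟩⟩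
  | mul j ℓ k p T ih =>
    exact ⟨⟨Nat.succ_le_succ hT.1, hT.2.mono (Nat.le_succ m)⟩, hT.1.trans (Nat.le_succ m), ih hT.2⟩
  | add S T ihS ihT => exact ⟨ihS hT.1, ihT hT.2⟩
  | sum S ih => exact fun e => ih e (hT e)

/-- The chain rule in (x, y) brings in the direction of y undifferentiated, with derivatives falling
on x only. This is why no smoothness is lost in C^i. -/
theorem OrderLE.vary {m : ℕ} (r : ℕ) {T : DiffExpr P P₁} (hT : T.OrderLE m) :
    (T.vary r).OrderLE m := by
  induction T with
  | comp j =>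
    cases j
    · exact ⟨trivial, fun e => ⟨Nat.zero_le _, trivial⟩⟩
    · exact fun e => ⟨Nat.zero_le _, trivial⟩
  | mul j ℓ k p T ih =>
    cases j
    · exact ⟨hT, hT.1, ih hT.2⟩
    · exact ⟨hT.1, ih hT.2⟩
  | add S T ihS ihT => exact ⟨ihS hT.1, ihT hT.2⟩
  | sum S ih => exact fun e => ih e (hT e)

theorem Below.spatial {r : ℕ} (q : P) {T : DiffExpr P P₁} (hT : T.Below r) :
    (T.spatial q).Below r := by
  induction T with
  | comp => exact ⟨hT, fun e => ⟨by simp, hT⟩⟩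
  | mul j ℓ k p T ih => exact ⟨hT, hT.1, ih hT.2⟩
  | add S T ihS ihT => exact ⟨ihS hT.1, ihT hT.2⟩
  | sum S ih => exact fun e => ih e (hT e)

theorem Below.vary {r : ℕ} {T : DiffExpr P P₁} (hT : T.Below r) : (T.vary r).Below (r + 1) := by
  have mono : ∀ {T : DiffExpr P P₁}, T.Below r → T.Below (r + 1) := by
    intro T hT
    induction T with
    | comp => exact fun n hn => (hT n hn).trans (Nat.lt_succ_self r)
    | mul j ℓ k p T ih => exact ⟨fun n hn => (hT.1 n hn).trans (Nat.lt_succ_self r), ih hT.2⟩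
    | add S T ihS ihT => exact ⟨ihS hT.1, ihT hT.2⟩
    | sum S ih => exact fun e => ih e (hT e)
  induction T with
  | comp j k w =>
    have := mono (T := comp j k w) hT
    cases j
    · exact ⟨by simp [Below], fun e => ⟨by simp, by simp [Below]⟩⟩
    · exact fun e => ⟨by simp, this⟩
  | mul j ℓ k p T ih =>
    cases j
    · exact ⟨⟨by simp, mono hT.2⟩, by simp, ih hT.2⟩
    · exact ⟨fun n hn => (hT.1 n hn).trans (Nat.lt_succ_self r), ih hT.2⟩
  | add S T ihS ihT => exact ⟨ihS hT.1, ihT hT.2⟩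
  | sum S ih => exact fun e => ih e (hT e)

/-- The iterated formal derivative with respect to the argument. -/
def spatialIter : (k : ℕ) → (Fin k → P) → DiffExpr P P₁ → DiffExpr P P₁
  | 0, _, T => T
  | k + 1, p, T => (spatialIter k (Fin.init p) T).spatial (p (Fin.last k))

theorem OrderLE.spatialIter {m : ℕ} {T : DiffExpr P P₁} (hT : T.OrderLE m) :
    ∀ (k : ℕ) (p : Fin k → P), (T.spatialIter k p).OrderLE (m + k)
  | 0, _ => hT
  | k + 1, p => (OrderLE.spatialIter hT k (Fin.init p)).spatial _

theorem Below.spatialIter {r : ℕ} {T : DiffExpr P P₁} (hT : T.Below r) :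
    ∀ (k : ℕ) (p : Fin k → P), (T.spatialIter k p).Below r
  | 0, _ => hT
  | k + 1, p => (Below.spatialIter hT k (Fin.init p)).spatial _

variable (P P₁) in
/-- The formal variation of order `l` of the superposition map. -/
def variation : ℕ → DiffExpr P P₁
  | 0 => comp none 0 Fin.elim0
  | l + 1 => (variation l).vary l

theorem orderLE_variation : ∀ l : ℕ, (variation P P₁ l).OrderLE 0
  | 0 => trivial
  | l + 1 => (orderLE_variation l).vary l

theorem below_variation : ∀ l : ℕ, (variation P P₁ l).Below l
  | 0 => by simp [variation, Below]
  | l + 1 => (below_variation l).vary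

end DiffExpr

/-! ### Evaluation of expressions -/

variable {i : ℕ∞} {Q : Set P} {hQ : IsRegular Q} {O : Set (P × P₁)} {hO' : IsRegular O}

variable (P₂ i hQ hO') in
/-- The product space on which the superposition map is defined. -/
abbrev Source : Type _ := CkSpace (⊤ : ℕ∞) O hO' P₂ × CkSpace i Q hQ P₁

/-- The pairs `(x, y)` such that the graph of `y` is contained in the domain of `x`. -/
def graphDomain (P₂ : Type*) [NormedAddCommGroup P₂] [NormedSpace ℝ P₂] (i : ℕ∞) (hQ : IsRegular Q)
    (hO' : IsRegular O) : Set (Source P₂ i hQ hO') :=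
  {z | ∀ η : Q, ((η : P), z.2.toFun η) ∈ O}

theorem isOpen_graphDomain (hO : RelOpen Q O)
    (hhole : ∃ K : Set P, IsCompact K ∧ K ⊆ Q ∧ Prod.fst '' (Q ×ˢ univ \ O) ⊆ K) :
    IsOpen (graphDomain P₂ i hQ hO') := by
  have h1 : Continuous fun z : Source P₂ i hQ hO' => CkSpace.der 0 Fin.elim0 z.2 := by fun_prop
  simp only [CkSpace.der_zero] at h1
  exact (isOpen_setOf_graph_subset hO hhole).preimage h1

/-- The variable with a given index. -/
def pick {X : Type*} (z : X) (θ : ℕ → X) : Option ℕ → X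
  | none => z
  | some j => θ j

theorem continuous_pick {X : Type*} [TopologicalSpace X] {A : Set X} (j : Option ℕ) :
    Continuous fun q : A × (ℕ → X) => pick q.1.1 q.2 j := by
  cases j
  · exact continuous_subtype_val.comp continuous_fst
  · exact (continuous_apply _).comp continuous_snd

namespace DiffExpr

/-- The function described by an expression. -/
def eval (z : graphDomain P₂ i hQ hO') (θ : ℕ → Source P₂ i hQ hO') : DiffExpr P P₁ → C(Q, P₂)
  | comp j k w => (CkSpace.der k w (pick z.1 θ j).1).comp (graphMap z.1.2.toFun z.2)
  | mul j ℓ k p T =>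
    ⟨fun η => ℓ (CkSpace.der k p (pick z.1 θ j).2 η) • eval z θ T η, by fun_prop⟩
  | add S T => eval z θ S + eval z θ T
  | sum S => ∑ e, eval z θ (S e)

theorem eval_comp (z : graphDomain P₂ i hQ hO') (θ : ℕ → Source P₂ i hQ hO') (j : Option ℕ)
    (k : ℕ) (w : Fin k → P × P₁) (η : Q) : eval z θ (comp j k w) η =
      CkSpace.der k w (pick z.1 θ j).1 ⟨((η : P), z.1.2.toFun η), z.2 η⟩ := rfl

theorem eval_mul (z : graphDomain P₂ i hQ hO') (θ : ℕ → Source P₂ i hQ hO') (j : Option ℕ)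
    (ℓ : P₁ →L[ℝ] ℝ) (k : ℕ) (p : Fin k → P) (T : DiffExpr P P₁) (η : Q) : eval z θ (mul j ℓ k p T) η =
      ℓ (CkSpace.der k p (pick z.1 θ j).2 η) • eval z θ T η := rfl

theorem eval_add (z : graphDomain P₂ i hQ hO') (θ : ℕ → Source P₂ i hQ hO') (S T : DiffExpr P P₁)
    (η : Q) : eval z θ (add S T) η = eval z θ S η + eval z θ T η := rfl

theorem eval_sum (z : graphDomain P₂ i hQ hO') (θ : ℕ → Source P₂ i hQ hO')
    (S : Fin (Module.finrank ℝ P₁) → DiffExpr P P₁) (η : Q) :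
    eval z θ (sum S) η = ∑ e, eval z θ (S e) η := by
  simp [eval]

theorem continuous_eval [FiniteDimensional ℝ P] (hO : RelOpen Q O) (T : DiffExpr P P₁) :
    Continuous fun q : graphDomain P₂ i hQ hO' × (ℕ → Source P₂ i hQ hO') => eval q.1 q.2 T := by
  induction T with
  | comp j k w =>
    have h1 : Continuous fun q : graphDomain P₂ i hQ hO' × (ℕ → Source P₂ i hQ hO') =>
        CkSpace.der k w (pick q.1.1 q.2 j).1 :=
      (CkSpace.der k w).continuous.comp (continuous_fst.comp (continuous_pick j))
    have h2 : Continuous fun q : graphDomain P₂ i hQ hO' × (ℕ → Source P₂ i hQ hO') =>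
        q.1.1.2.toFun := by
      have : Continuous fun q : graphDomain P₂ i hQ hO' × (ℕ → Source P₂ i hQ hO') =>
        CkSpace.der 0 Fin.elim0 q.1.1.2 := by fun_prop
      simpa only [CkSpace.der_zero] using this
    exact (continuous_comp_graphMap hO).comp (h1.prodMk (h2.subtype_mk fun q => q.1.2))
  | mul j ℓ k p T ih =>
    have h1 : Continuous fun q : graphDomain P₂ i hQ hO' × (ℕ → Source P₂ i hQ hO') =>
        CkSpace.der k p (pick q.1.1 q.2 j).2 :=
      (CkSpace.der k p).continuous.comp (continuous_snd.comp (continuous_pick j))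
    refine continuous_iff_uncurry_compact.2 fun K hK => ?_
    exact (ℓ.continuous.comp (continuous_iff_uncurry_compact.1 h1 K hK)).smul
      (continuous_iff_uncurry_compact.1 ih K hK)
  | add S T ihS ihT => exact ihS.add ihT
  | sum S ih => exact continuous_finsetSum _ fun e _ => ih e

/-- Directions that do not occur are irrelevant. -/
theorem eval_congr {r : ℕ} {T : DiffExpr P P₁} (hT : T.Below r) (z : graphDomain P₂ i hQ hO')
    {θ θ' : ℕ → Source P₂ i hQ hO'} (h : ∀ n < r, θ n = θ' n) : eval z θ T = eval z θ' T := by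
  have hpick : ∀ j : Option ℕ, (∀ n ∈ j, n < r) → pick z.1 θ j = pick z.1 θ' j := by
    rintro (_ | j) hj
    · rfl
    · exact h j (hj j rfl)
  induction T with
  | comp j k w => simp only [eval, hpick j hT]
  | mul j ℓ k p T ih => simp only [eval, hpick j hT.1, ih hT.2]
  | add S T ihS ihT => simp only [eval, ihS hT.1, ihT hT.2]
  | sum S ih => simp only [eval, fun e => ih e (hT e)]

/-- The formal derivative is linear in the direction. -/
theorem eval_vary_update {r : ℕ} {T : DiffExpr P P₁} (hT : T.Below r) (z : graphDomain P₂ i hQ hO')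
    (θ : ℕ → Source P₂ i hQ hO') (c : ℝ) (a b : Source P₂ i hQ hO') (η : Q) :
    eval z (Function.update θ r (c • a + b)) (T.vary r) η =
      c • eval z (Function.update θ r a) (T.vary r) η
        + eval z (Function.update θ r b) (T.vary r) η := by
  -- As the index r is new, each term of `T.vary r` contains exactly one factor depending on the
  -- direction r, and that factor is linear in it.
  have hind : ∀ {T : DiffExpr P P₁}, T.Below r → ∀ a, eval z (Function.update θ r a) T = eval z θ T :=
    fun hT a => eval_congr hT z fun n hn => Function.update_of_ne hn.ne _ _
  have hpick : ∀ j : Option ℕ, (∀ n ∈ j, n < r) → ∀ a,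
      pick z.1 (Function.update θ r a) j = pick z.1 θ j := by
    rintro (_ | j) hj a
    · rfl
    · exact Function.update_of_ne (hj j rfl).ne _ _
  have hr : ∀ a, pick z.1 (Function.update θ r a) (some r) = a := fun a => Function.update_self ..
  have hsum : ∀ {j : Option ℕ} {k : ℕ} {w : Fin k → P × P₁}, (∀ n ∈ j, n < r) →
      ∑ e, eval z (Function.update θ r (c • a + b)) (mul (some r) (coordL P₁ e) 0 Fin.elim0
        (comp j (k + 1) (Fin.snoc w (fibreBasis P e)))) η =
      c • ∑ e, eval z (Function.update θ r a) (mul (some r) (coordL P₁ e) 0 Fin.elim0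
        (comp j (k + 1) (Fin.snoc w (fibreBasis P e)))) η
      + ∑ e, eval z (Function.update θ r b) (mul (some r) (coordL P₁ e) 0 Fin.elim0
        (comp j (k + 1) (Fin.snoc w (fibreBasis P e)))) η := by
    intro j k w hj
    rw [Finset.smul_sum, ← Finset.sum_add_distrib]
    refine Finset.sum_congr rfl fun e _ => ?_
    simp only [eval_mul, eval_comp, hr, hpick j hj, Prod.snd_add, Prod.smul_snd, map_add, map_smul,
      ContinuousMap.add_apply, ContinuousMap.smul_apply, add_smul, smul_assoc]
  induction T with
  | comp j k w =>
    cases j with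
    | none =>
      simp only [vary, eval_add, eval_sum, hsum hT]
      simp only [eval_comp, hr, Prod.fst_add, Prod.smul_fst, map_add, map_smul,
        ContinuousMap.add_apply, ContinuousMap.smul_apply]
      module
    | some j =>
      simp only [vary, eval_sum, hsum hT]
  | mul j ℓ k p T ih =>
    cases j with
    | none =>
      simp only [vary, eval_add, eval_mul, hr, hind hT.2, ih hT.2, hpick none hT.1, Prod.snd_add,
        Prod.smul_snd, map_add, map_smul, ContinuousMap.add_apply, ContinuousMap.smul_apply]
      module
    | some j =>
      simp only [vary, eval_mul, ih hT.2, hpick (some j) hT.1]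
      module
  | add S T ihS ihT =>
    simp only [vary, eval_add, ihS hT.1, ihT hT.2]
    module
  | sum S ih =>
    simp only [vary, eval_sum, fun e => ih e (hT e), Finset.sum_add_distrib, Finset.smul_sum]

end DiffExpr

end

/-! ### Formal derivatives as genuine derivatives -/

section

variable {P P₁ P₂ : Type*}
  [NormedAddCommGroup P] [NormedSpace ℝ P] [FiniteDimensional ℝ P]
  [NormedAddCommGroup P₁] [NormedSpace ℝ P₁] [FiniteDimensional ℝ P₁]
  [NormedAddCommGroup P₂] [NormedSpace ℝ P₂]

variable {i : ℕ∞} {Q : Set P} {hQ : IsRegular Q} {O : Set (P × P₁)} {hO' : IsRegular O}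

/-- Brings the chain rule into the coordinate form used by `spatial` and `vary`, where the direction
no longer depends on the point. -/
theorem der_snoc_prod (k : ℕ) (w : Fin k → P × P₁) (x : CkSpace (⊤ : ℕ∞) O hO' P₂) (q : P)
    (b : P₁) : CkSpace.der (k + 1) (Fin.snoc w (q, b) : Fin (k + 1) → P × P₁) x =
      CkSpace.der (k + 1) (Fin.snoc w (q, 0) : Fin (k + 1) → P × P₁) x
        + ∑ e, coordL P₁ e b •
          CkSpace.der (k + 1) (Fin.snoc w (fibreBasis P e) : Fin (k + 1) → P × P₁) x := by
  have hlin := CkSpace.der_snoc_linear (k := k) le_top w x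
  have h0 : CkSpace.der (k + 1) (Fin.snoc w 0 : Fin (k + 1) → P × P₁) x = 0 := by
    simpa using hlin 1 0 0
  let L : P × P₁ →ₗ[ℝ] C(O, P₂) :=
    { toFun := fun v => CkSpace.der (k + 1) (Fin.snoc w v : Fin (k + 1) → P × P₁) x
      map_add' := fun a b => by simpa using hlin 1 a b
      map_smul' := fun c a => by simpa [h0] using hlin c a 0 }
  have hsum : ((q, b) : P × P₁) = (q, 0) + ∑ e, coordL P₁ e b • fibreBasis P e := by
    have : ∑ e, coordL P₁ e b • fibreBasis P e
        = LinearMap.inr ℝ P P₁ (∑ e, coordL P₁ e b • Module.finBasis ℝ P₁ e) := by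
      rw [map_sum]
      simp [fibreBasis]
    rw [this, sum_coordL_smul]
    simp
  change L (q, b) = L (q, 0) + ∑ e, coordL P₁ e b • L (fibreBasis P e)
  rw [hsum, map_add, map_sum]
  simp only [map_smul]

namespace DiffExpr

/-- The formal derivative with respect to the argument is the derivative at interior points. -/
theorem hasDerivAt_eval_spatial (hO : RelOpen Q O) {m : ℕ} (hm : ((m + 1 : ℕ) : ℕ∞) ≤ i)
    {T : DiffExpr P P₁} (hT : T.OrderLE m) (z : graphDomain P₂ i hQ hO')
    (θ : ℕ → Source P₂ i hQ hO') (q : P) {η : P} (hη : η ∈ interior Q) :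
    HasDerivAt (fun s : ℝ => extZero (eval z θ T) (η + s • q))
      (extZero (eval z θ (T.spatial q)) η) 0 := by
  have hηQ : η ∈ Q := interior_subset hη
  have hev : ∀ᶠ s in 𝓝 (0 : ℝ), η + s • q ∈ Q := by
    have hc : Continuous fun s : ℝ => η + s • q := by fun_prop
    refine hc.continuousAt.eventually (p := fun y => y ∈ Q) ?_
    simpa using mem_interior_iff_mem_nhds.1 hη
  rw [extZero_of_mem _ hηQ]
  induction T with
  | comp j k w =>
    set x := (pick z.1 θ j).1
    set y := z.1.2
    -- Even a term without factors from y requires one derivative of y, because the graph moves with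
    -- η.
    have h1 : ((0 + 1 : ℕ) : ℕ∞) ≤ i := le_trans (by exact_mod_cast Nat.succ_le_succ m.zero_le) hm
    have hy := CkSpace.hasDerivAt_der h1 Fin.elim0 q y hη
    rw [CkSpace.der_zero, extZero_of_mem _ hηQ] at hy
    have hl : HasDerivAt (fun s : ℝ => η + s • q) q 0 := by
      simpa using ((hasDerivAt_id (0 : ℝ)).smul_const q).const_add η
    have hpt : (η, y.toFun ⟨η, hηQ⟩) ∈ O := z.2 ⟨η, hηQ⟩
    have hint := hO.mem_interior hpt hη
    have hg := CkSpace.hasFDerivAt_der (k := k) le_top w x hint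
    have hg' : HasFDerivAt (extZero (CkSpace.der k w x))
        (CkSpace.grad k w x (η, y.toFun ⟨η, hηQ⟩))
        (η + (0 : ℝ) • q, extZero y.toFun (η + (0 : ℝ) • q)) := by
      simpa [extZero_of_mem _ hηQ] using hg
    have hmain := hg'.comp_hasDerivAt (0 : ℝ) (hl.prodMk hy)
    rw [CkSpace.grad_apply le_top w x hint, extZero_of_mem _ hpt, der_snoc_prod] at hmain
    convert hmain.congr_of_eventuallyEq ?_ using 1
    · simp only [spatial, eval_add, eval_sum, eval_mul, eval_comp, ContinuousMap.add_apply,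
        ContinuousMap.sum_apply, ContinuousMap.smul_apply]
      rfl
    · filter_upwards [hev] with s hs
      simp only [Function.comp_apply]
      rw [extZero_of_mem _ hs, extZero_of_mem _ hs, extZero_of_mem _ (z.2 ⟨_, hs⟩)]
      rfl
  | mul j ℓ k p T ih =>
    have hk : ((k + 1 : ℕ) : ℕ∞) ≤ i :=
      le_trans (by exact_mod_cast Nat.succ_le_succ hT.1) hm
    have h1 := CkSpace.hasDerivAt_der hk p q (pick z.1 θ j).2 hη
    rw [extZero_of_mem _ hηQ] at h1
    have h2 := (ℓ.hasFDerivAt.comp_hasDerivAt (0 : ℝ) h1).smul (ih hT.2)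
    convert h2.congr_of_eventuallyEq ?_ using 1
    · simp only [spatial, eval_add, eval_mul, Function.comp_apply, zero_smul, add_zero,
        extZero_of_mem _ hηQ]
      rw [add_comm]
    · filter_upwards [hev] with s hs
      simp only [Pi.smul_apply', Function.comp_apply, extZero_of_mem _ hs]
      rfl
  | add S T ihS ihT =>
    refine ((ihS hT.1).add (ihT hT.2)).congr_of_eventuallyEq ?_
    filter_upwards [hev] with s hs
    simp only [Pi.add_apply, extZero_of_mem _ hs]
    rfl
  | sum S ih =>
    have h1 := HasDerivAt.fun_sum (u := Finset.univ) fun e _ => ih e (hT e)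
    simp only [spatial, eval_sum]
    refine h1.congr_of_eventuallyEq ?_
    filter_upwards [hev] with s hs
    simp only [extZero_of_mem _ hs, eval_sum]

theorem eventually_line_mem_nhds {X : Type*} [AddCommGroup X] [Module ℝ X] [TopologicalSpace X]
    [IsTopologicalAddGroup X] [ContinuousSMul ℝ X] {A : Set X} (hA : IsOpen A) {x : X}
    (hx : x ∈ A) (u : X) : ∀ᶠ t in 𝓝 (0 : ℝ), x + t • u ∈ A := by
  have hc : Continuous fun t : ℝ => x + t • u := by fun_prop
  exact hc.continuousAt.eventually (hA.mem_nhds (by simpa using hx))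

/-- The formal derivative with respect to the base point is the derivative, at all points. -/
theorem hasDerivAt_eval_vary (hO : RelOpen Q O) (hΩ : IsOpen (graphDomain P₂ i hQ hO'))
    {r : ℕ} {T : DiffExpr P P₁} (hT : T.Below r) (z : graphDomain P₂ i hQ hO')
    (θ : ℕ → Source P₂ i hQ hO') (v : Source P₂ i hQ hO') (η : Q) :
    HasDerivAt (fun t : ℝ => extZero (fun z' : graphDomain P₂ i hQ hO' => eval z' θ T η)
      ((z : Source P₂ i hQ hO') + t • v))
      (eval z (Function.update θ r v) (T.vary r) η) 0 := by
  have hind : ∀ {T : DiffExpr P P₁}, T.Below r → eval z (Function.update θ r v) T = eval z θ T :=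
    fun hT => eval_congr hT z fun n hn => Function.update_of_ne hn.ne _ _
  have hpick : ∀ j : Option ℕ, (∀ n ∈ j, n < r) →
      pick z.1 (Function.update θ r v) j = pick z.1 θ j := by
    rintro (_ | j) hj
    · rfl
    · exact Function.update_of_ne (hj j rfl).ne _ _
  have hr : pick z.1 (Function.update θ r v) (some r) = v := Function.update_self ..
  have hev := eventually_line_mem_nhds hΩ z.2 v
  have hz0 : (z : Source P₂ i hQ hO') + (0 : ℝ) • v ∈ graphDomain P₂ i hQ hO' := by simp
  -- At fixed η, changing y moves the graph point along the fibre only, so η need not be interior.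
  have fibre : ∀ (k : ℕ) (w : Fin k → P × P₁) (x : CkSpace (⊤ : ℕ∞) O hO' P₂),
      HasDerivAt (fun t : ℝ => extZero (CkSpace.der k w x) ((η : P), z.1.2.toFun η + t • v.2.toFun η))
        (∑ e, coordL P₁ e (v.2.toFun η) •
          CkSpace.der (k + 1) (Fin.snoc w (fibreBasis P e) : Fin (k + 1) → P × P₁) x
            ⟨((η : P), z.1.2.toFun η), z.2 η⟩) 0 := by
    intro k w x
    have h1 := hasDerivAt_der_fibre hQ hO le_top w x (z.2 η) (v.2.toFun η)
    have h0 : CkSpace.der (k + 1) (Fin.snoc w (0 : P × P₁) : Fin (k + 1) → P × P₁) x = 0 := by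
      simpa using CkSpace.der_snoc_linear (k := k) le_top w x 1 0 0
    rw [extZero_of_mem _ (z.2 η), der_snoc_prod, ← Prod.zero_eq_mk, h0, zero_add] at h1
    simpa only [ContinuousMap.sum_apply, ContinuousMap.smul_apply] using h1
  induction T with
  | comp j k w =>
    cases j with
    | none =>
      -- By linearity of d̄(w), the value along the line is the contribution of x plus t times that
      -- of the direction, both taken at the moving graph point.
      have h1 := (fibre k w z.1.1).add ((hasDerivAt_id (0 : ℝ)).smul (fibre k w v.1))
      convert h1.congr_of_eventuallyEq ?_ using 1
      · simp only [vary, eval_add, eval_sum, eval_mul, eval_comp, hr, hpick none hT]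
        simp only [CkSpace.der_zero, id, zero_smul, add_zero, zero_add, one_smul,
          extZero_of_mem _ (z.2 η)]
        rw [add_comm]
        rfl
      · filter_upwards [hev] with t ht
        have hmem : ((η : P), z.1.2.toFun η + t • v.2.toFun η) ∈ O := ht η
        simp only [Pi.add_apply, Pi.smul_apply', id]
        rw [extZero_of_mem _ ht, extZero_of_mem _ hmem, extZero_of_mem _ hmem, eval_comp]
        simp only [pick, Prod.fst_add, Prod.smul_fst, map_add, map_smul, ContinuousMap.add_apply,
          ContinuousMap.smul_apply]
        rfl
    | some j =>
      convert (fibre k w (θ j).1).congr_of_eventuallyEq ?_ using 1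
      · simp only [vary, eval_sum, eval_mul, eval_comp, hr, hpick (some j) hT, CkSpace.der_zero]
        rfl
      · filter_upwards [hev] with t ht
        have hmem : ((η : P), z.1.2.toFun η + t • v.2.toFun η) ∈ O := ht η
        rw [extZero_of_mem _ ht, extZero_of_mem _ hmem, eval_comp]
        rfl
  | mul j ℓ k p T ih =>
    cases j with
    | none =>
      have h1 : HasDerivAt (fun t : ℝ => ℓ (CkSpace.der k p z.1.2 η) + t • ℓ (CkSpace.der k p v.2 η))
          (ℓ (CkSpace.der k p v.2 η)) 0 := by
        simpa using ((hasDerivAt_id (0 : ℝ)).smul_const (ℓ (CkSpace.der k p v.2 η))).const_add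
          (ℓ (CkSpace.der k p z.1.2 η))
      convert (h1.smul (ih hT.2)).congr_of_eventuallyEq ?_ using 1
      · simp only [vary, eval_add, eval_mul, hr, hind hT.2, hpick none hT.1]
        simp only [zero_smul, add_zero, extZero_of_mem _ z.2]
        rw [add_comm]
        rfl
      · filter_upwards [hev] with t ht
        simp only [Pi.smul_apply', extZero_of_mem _ ht, eval_mul]
        simp only [pick, Prod.snd_add, Prod.smul_snd, map_add, map_smul, ContinuousMap.add_apply,
          ContinuousMap.smul_apply]
    | some j =>
      convert ((ih hT.2).const_smul (ℓ (CkSpace.der k p (θ j).2 η))).congr_of_eventuallyEq ?_ using 1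
      · simp only [vary, eval_mul, hpick (some j) hT.1]
        rfl
      · filter_upwards [hev] with t ht
        simp only [Pi.smul_apply, extZero_of_mem _ ht, eval_mul]
        rfl
  | add S T ihS ihT =>
    refine ((ihS hT.1).add (ihT hT.2)).congr_of_eventuallyEq ?_
    filter_upwards [hev] with t ht
    simp only [Pi.add_apply, extZero_of_mem _ ht]
    rfl
  | sum S ih =>
    have h1 := HasDerivAt.fun_sum (u := Finset.univ) fun e _ => ih e (hT e)
    simp only [vary, eval_sum]
    refine h1.congr_of_eventuallyEq ?_
    filter_upwards [hev] with t ht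
    simp only [extZero_of_mem _ ht]

/-- The two formal derivatives commute. -/
theorem eval_spatial_vary (z : graphDomain P₂ i hQ hO') (θ : ℕ → Source P₂ i hQ hO') (q : P)
    (r : ℕ) (T : DiffExpr P P₁) : eval z θ ((T.vary r).spatial q) = eval z θ ((T.spatial q).vary r) := by
  ext η
  induction T with
  | comp j k w =>
    have hsymm := fun (x : CkSpace (⊤ : ℕ∞) O hO' P₂) =>
      CkSpace.der_snoc_comm (k := k) le_top w x
    -- Moving the graph twice gives a double sum over fibre directions, in opposite orders on the
    -- two sides; symmetry of the derivatives of x identifies them.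
    have hswap : ∀ A B : Fin (Module.finrank ℝ P₁) → ℝ,
        ∀ D : Fin (Module.finrank ℝ P₁) → Fin (Module.finrank ℝ P₁) → P₂,
        (∀ e e', D e e' = D e' e) →
        ∑ e, ∑ e', A e • B e' • D e e' = ∑ e, ∑ e', B e • A e' • D e e' := by
      intro A B D hD
      rw [Finset.sum_comm]
      refine Finset.sum_congr rfl fun e _ => Finset.sum_congr rfl fun e' _ => ?_
      rw [smul_comm, hD]
    cases j <;>
    · simp only [vary, spatial, eval_add, eval_sum, eval_mul, eval_comp, smul_add,
        Finset.sum_add_distrib, Finset.smul_sum]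
      simp only [fun x e => hsymm x (fibreBasis P e) (q, 0)]
      rw [hswap _ _ (fun e e' => CkSpace.der (k + 2)
        (Fin.snoc (Fin.snoc w (fibreBasis P e) : Fin (k + 1) → P × P₁) (fibreBasis P e') :
          Fin (k + 2) → P × P₁) _ ⟨((η : P), z.1.2.toFun η), z.2 η⟩)
        fun e e' => by rw [hsymm]]
      abel
  | mul j ℓ k p T ih =>
    cases j with
    | none =>
      simp only [vary, spatial, eval_add, eval_mul, ih]
      abel
    | some j => simp only [vary, spatial, eval_add, eval_mul, ih]
  | add S T ihS ihT => simp only [vary, spatial, eval_add, ihS, ihT]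
  | sum S ih => simp only [vary, spatial, eval_sum, ih]

end DiffExpr

end

/-! ### Expressions as elements of C^i, and their multilinearity -/

section

variable {P P₁ P₂ : Type*}
  [NormedAddCommGroup P] [NormedSpace ℝ P] [FiniteDimensional ℝ P]
  [NormedAddCommGroup P₁] [NormedSpace ℝ P₁] [FiniteDimensional ℝ P₁]
  [NormedAddCommGroup P₂] [NormedSpace ℝ P₂]

variable {i : ℕ∞} {Q : Set P} {hQ : IsRegular Q} {O : Set (P × P₁)} {hO' : IsRegular O}

namespace CkSpace

theorem continuous_iff_der {X F : Type*} [TopologicalSpace X] [NormedAddCommGroup F]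
    [NormedSpace ℝ F] {f : X → CkSpace i Q hQ F} :
    Continuous f ↔ ∀ k : ℕ, (k : ℕ∞) ≤ i → ∀ u : Fin k → P, Continuous fun a => der k u (f a) := by
  refine ⟨fun h k _ u => (der k u).continuous.comp h, fun h => continuous_induced_rng.2 ?_⟩
  refine continuous_pi fun k => continuous_pi fun u => ?_
  refine (h k k.2 u).congr fun a => ?_
  rw [der_eq k.2]
  rfl

theorem tendsto_iff_der {X F : Type*} [NormedAddCommGroup F]
    [NormedSpace ℝ F] {l : Filter X} {f : X → CkSpace i Q hQ F} {g : CkSpace i Q hQ F} :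
    Tendsto f l (𝓝 g) ↔ ∀ k : ℕ, (k : ℕ∞) ≤ i → ∀ u : Fin k → P, ∀ K : Set Q, IsCompact K →
      ∀ ε : ℝ, 0 < ε → ∀ᶠ a in l, ∀ η ∈ K, ‖der k u (f a) η - der k u g η‖ < ε := by
  have h1 : Tendsto f l (𝓝 g) ↔ ∀ k : ℕ, (k : ℕ∞) ≤ i → ∀ u : Fin k → P,
      Tendsto (fun a => der k u (f a)) l (𝓝 (der k u g)) := by
    refine ⟨fun h k _ u => ((der k u).continuous.tendsto g).comp h, fun h => ?_⟩
    rw [nhds_induced, tendsto_comap_iff]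
    refine tendsto_pi_nhds.2 fun k => tendsto_pi_nhds.2 fun u => ?_
    have := h k k.2 u
    simp only [der_eq k.2] at this
    exact this
  rw [h1]
  refine forall_congr' fun k => forall_congr' fun _ => forall_congr' fun u => ?_
  rw [ContinuousMap.tendsto_iff_forall_isCompact_tendstoUniformlyOn]
  refine forall_congr' fun K => forall_congr' fun _ => ?_
  rw [Metric.tendstoUniformlyOn_iff]
  simp only [dist_eq_norm, norm_sub_rev (der k u g _), gt_iff_lt]

/-- A property of sets which is inherited by supersets and finite intersections holds for all zero
neighbourhoods if it holds for the basic ones. -/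
theorem nhds_zero_induction {F : Type*} [NormedAddCommGroup F] [NormedSpace ℝ F]
    {G : Set (CkSpace i Q hQ F) → Prop} (huniv : G univ)
    (hmono : ∀ {A B}, G A → A ⊆ B → G B) (hinter : ∀ {A B}, G A → G B → G (A ∩ B))
    (hbasic : ∀ k : ℕ, (k : ℕ∞) ≤ i → ∀ u : Fin k → P, ∀ K : Set Q, IsCompact K →
      ∀ ε : ℝ, 0 < ε → G {f | ∀ η ∈ K, ‖der k u f η‖ < ε}) :
    ∀ W ∈ 𝓝 (0 : CkSpace i Q hQ F), G W := by
  -- The sets with property `G` form a filter; the basic case says that the identity tends to zero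
  -- along it, i.e. that it contains all zero neighbourhoods.
  let 𝓕 : Filter (CkSpace i Q hQ F) :=
    { sets := {W | G W}
      univ_sets := huniv
      sets_of_superset := fun h h' => hmono h h'
      inter_sets := fun h h' => hinter h h' }
  have : Tendsto id 𝓕 (𝓝 (0 : CkSpace i Q hQ F)) := by
    refine tendsto_iff_der.2 fun k hk u K hK ε hε => ?_
    refine mem_of_superset (show _ ∈ 𝓕 from hbasic k hk u K hK ε hε) fun f hf η hη => ?_
    simpa using hf η hη
  exact fun W hW => this hW

end CkSpace

namespace DiffExpr

/-- Each spatial derivative raises the order in y by at most one, so k ≤ i of them are admissible.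
The boundary condition is automatic because evaluations are continuous on all of Q. -/
theorem isExtDeriv_eval (hO : RelOpen Q O) {T : DiffExpr P P₁} (hT : T.OrderLE 0)
    (z : graphDomain P₂ i hQ hO') (θ : ℕ → Source P₂ i hQ hO') {k : ℕ} (hk : (k : ℕ∞) ≤ i)
    (p : Fin k → P) : IsExtDeriv (eval z θ T) p (eval z θ (T.spatialIter k p)) := by
  refine ⟨fun x hx => ?_, fun x _ =>
    (eval z θ (T.spatialIter k p)).continuous.continuousAt.continuousWithinAt⟩
  have key : ∀ (k : ℕ), (k : ℕ∞) ≤ i → ∀ (p : Fin k → P), ∀ η ∈ interior Q,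
      extZero (eval z θ (T.spatialIter k p)) η ∈ iterDirDeriv (toPartial (eval z θ T)) k p η := by
    intro k
    induction k with
    | zero =>
      intro _ p η hη
      exact ⟨interior_subset hη, (extZero_of_mem _ (interior_subset hη)).symm⟩
    | succ k ih =>
      intro hk p η hη
      refine mem_dirDeriv.2 ((hasDirDeriv_iff_hasDerivAt isOpen_interior
        (ih (le_trans (by exact_mod_cast Nat.le_succ k) hk) (Fin.init p)) hη _ _).2 ?_)
      exact hasDerivAt_eval_spatial hO (m := 0 + k) (by simpa using hk)
        (hT.spatialIter k _) z θ _ hη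
  have := key k hk p x hx
  rwa [extZero_of_mem _ x.2] at this

/-- The function described by an expression without derivatives of the inner function, as an
element of `C^i(Q, P₂)`. -/
def evalCk (hO : RelOpen Q O) {T : DiffExpr P P₁} (hT : T.OrderLE 0) (z : graphDomain P₂ i hQ hO')
    (θ : ℕ → Source P₂ i hQ hO') : CkSpace i Q hQ P₂ :=
  ⟨eval z θ T, fun _ hk p => ⟨_, isExtDeriv_eval hO hT z θ hk p⟩⟩

theorem der_evalCk (hO : RelOpen Q O) {T : DiffExpr P P₁} (hT : T.OrderLE 0)
    (z : graphDomain P₂ i hQ hO') (θ : ℕ → Source P₂ i hQ hO') {k : ℕ} (hk : (k : ℕ∞) ≤ i)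
    (p : Fin k → P) : CkSpace.der k p (evalCk hO hT z θ) = eval z θ (T.spatialIter k p) :=
  (CkSpace.isExtDeriv_der hk p (evalCk hO hT z θ)).unique hQ (isExtDeriv_eval hO hT z θ hk p)

/-- `spatial` acts on expressions, not on their values, so the inductive equality of values cannot
be differentiated formally. At interior points `spatial` is a true derivative and depends on the
value alone; density gives the rest. -/
theorem eval_spatialIter_vary (hO : RelOpen Q O) {T : DiffExpr P P₁} (hT : T.OrderLE 0)
    (z : graphDomain P₂ i hQ hO') (θ : ℕ → Source P₂ i hQ hO') (r : ℕ) :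
    ∀ (k : ℕ), (k : ℕ∞) ≤ i → ∀ (p : Fin k → P),
      eval z θ ((T.vary r).spatialIter k p) = eval z θ ((T.spatialIter k p).vary r) := by
  intro k
  induction k with
  | zero => intro _ p; rfl
  | succ k ih =>
    intro hk p
    have ih := ih (le_trans (by exact_mod_cast Nat.le_succ k) hk) (Fin.init p)
    refine Eq.trans ?_ (eval_spatial_vary z θ (p (Fin.last k)) r _)
    refine continuousMap_eq_of_eq_interior hQ fun η hη => ?_
    have hk' : ((0 + k + 1 : ℕ) : ℕ∞) ≤ i := by simpa using hk
    have h1 := hasDerivAt_eval_spatial hO hk' ((hT.vary r).spatialIter k (Fin.init p)) z θ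
      (p (Fin.last k)) hη
    have h2 := hasDerivAt_eval_spatial hO hk' ((hT.spatialIter k (Fin.init p)).vary r) z θ
      (p (Fin.last k)) hη
    rw [ih] at h1
    have := h1.unique h2
    rwa [extZero_of_mem _ η.2, extZero_of_mem _ η.2] at this

theorem hasDerivAt_line_eval_vary (hO : RelOpen Q O) (hΩ : IsOpen (graphDomain P₂ i hQ hO'))
    {r : ℕ} {T : DiffExpr P P₁} (hT : T.Below r) {z v : Source P₂ i hQ hO'} {t : ℝ}
    (hz : z + t • v ∈ graphDomain P₂ i hQ hO') (θ : ℕ → Source P₂ i hQ hO') (η : Q) :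
    HasDerivAt (fun t : ℝ => extZero (fun z' : graphDomain P₂ i hQ hO' => eval z' θ T η) (z + t • v))
      (extZero (fun z' : graphDomain P₂ i hQ hO' =>
        eval z' (Function.update θ r v) (T.vary r) η) (z + t • v)) t := by
  have := hasDerivAt_line_shift (hasDerivAt_eval_vary hO hΩ hT ⟨_, hz⟩ θ v η)
  rwa [extZero_of_mem _ hz]

/-- The formal variations are multilinear. -/
theorem eval_variation_update (hO : RelOpen Q O) (hΩ : IsOpen (graphDomain P₂ i hQ hO')) (l : ℕ) :
    ∀ j < l, ∀ (z : graphDomain P₂ i hQ hO') (θ : ℕ → Source P₂ i hQ hO') (c : ℝ)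
      (a b : Source P₂ i hQ hO') (η : Q),
      eval z (Function.update θ j (c • a + b)) (variation P P₁ l) η =
        c • eval z (Function.update θ j a) (variation P P₁ l) η
          + eval z (Function.update θ j b) (variation P P₁ l) η := by
  induction l with
  | zero => intro j hj; omega
  | succ l ih =>
    intro j hj z θ c a b η
    rcases Nat.lt_succ_iff_lt_or_eq.1 hj with hj | rfl
    -- Linearity in an old direction is inherited by differentiating the inductive identity with
    -- respect to the base point along `θ l`. The newest direction is covered by `eval_vary_update`.
    · have hd : ∀ d, HasDerivAt (fun t : ℝ => extZero (fun z' : graphDomain P₂ i hQ hO' =>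
          eval z' (Function.update θ j d) (variation P P₁ l) η)
          ((z : Source P₂ i hQ hO') + t • θ l))
          (eval z (Function.update θ j d) (variation P P₁ (l + 1)) η) 0 := by
        intro d
        have := hasDerivAt_eval_vary hO hΩ (below_variation l) z (Function.update θ j d) (θ l) η
        rwa [Function.update_eq_self_iff.2 (Function.update_of_ne hj.ne' _ _).symm] at this
      refine (hd (c • a + b)).unique ((((hd a).const_smul c).add (hd b)).congr_of_eventuallyEq ?_)
      filter_upwards [eventually_line_mem_nhds hΩ z.2 (θ l)] with t ht
      simp only [Pi.add_apply, Pi.smul_apply, extZero_of_mem _ ht]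
      exact ih j hj _ θ c a b η
    · exact eval_vary_update (below_variation j) z θ c a b η

theorem eval_vary_update_zero {r : ℕ} {T : DiffExpr P P₁} (hT : T.Below r)
    (z : graphDomain P₂ i hQ hO') (θ : ℕ → Source P₂ i hQ hO') (η : Q) :
    eval z (Function.update θ r 0) (T.vary r) η = 0 := by
  simpa using eval_vary_update hT z θ 1 0 0 η

theorem eval_vary_update_smul {r : ℕ} {T : DiffExpr P P₁} (hT : T.Below r)
    (z : graphDomain P₂ i hQ hO') (θ : ℕ → Source P₂ i hQ hO') (c : ℝ) (a : Source P₂ i hQ hO')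
    (η : Q) : eval z (Function.update θ r (c • a)) (T.vary r) η =
      c • eval z (Function.update θ r a) (T.vary r) η := by
  simpa [eval_vary_update_zero hT] using eval_vary_update hT z θ c a 0 η

end DiffExpr

/-! ### The variations of the superposition map -/

/-- The extension by zero of a finite family of directions to a sequence. -/
def dirs {X : Type*} [Zero X] {l : ℕ} (u : Fin l → X) (n : ℕ) : X :=
  if h : n < l then u ⟨n, h⟩ else 0

theorem continuous_dirs {X : Type*} [Zero X] [TopologicalSpace X] {l : ℕ} :
    Continuous (dirs : (Fin l → X) → ℕ → X) := by
  refine continuous_pi fun n => ?_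
  unfold dirs
  split_ifs <;> fun_prop

theorem dirs_update {X : Type*} [Zero X] {l : ℕ} (u : Fin l → X) (j : Fin l) (a : X) :
    dirs (Function.update u j a) = Function.update (dirs u) j a := by
  funext n
  by_cases h : n < l
  · by_cases hj : n = j
    · subst hj
      simp [dirs]
    · have : (⟨n, h⟩ : Fin l) ≠ j := fun h' => hj (congrArg Fin.val h')
      simp [dirs, h, Function.update_of_ne hj, Function.update_of_ne this]
  · have hj : n ≠ j := fun h' => h (h' ▸ j.2)
    simp [dirs, h, Function.update_of_ne hj]

theorem update_dirs_init {X : Type*} [Zero X] {l : ℕ} (u : Fin (l + 1) → X) :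
    Function.update (dirs (Fin.init u)) l (u (Fin.last l)) = dirs u := by
  funext n
  rcases lt_trichotomy n l with h | rfl | h
  · simp [dirs, h, Function.update_of_ne h.ne, Fin.init, h.trans (Nat.lt_succ_self l)]
  · simp [dirs, Fin.last]
  · simp [dirs, Function.update_of_ne h.ne', not_lt.2 h.le, not_lt.2 (Nat.succ_le_of_lt h)]

open DiffExpr Classical in
/-- The variations of the superposition map. -/
def superpositionDeriv (hO : RelOpen Q O) (hΩ : IsOpen (graphDomain P₂ i hQ hO')) (l : ℕ)
    (z : Source P₂ i hQ hO') :
    ContinuousMultilinearMap ℝ (fun _ : Fin l => Source P₂ i hQ hO') (CkSpace i Q hQ P₂) :=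
  if hz : z ∈ graphDomain P₂ i hQ hO' then
    { toFun := fun u => evalCk hO (orderLE_variation l) ⟨z, hz⟩ (dirs u)
      map_update_add' := by
        intro inst u j a b
        rw [Subsingleton.elim inst (instDecidableEqFin l)]
        refine Subtype.ext (ContinuousMap.ext fun η => ?_)
        have := eval_variation_update hO hΩ l j j.2 ⟨z, hz⟩ (dirs u) 1 a b η
        simp only [one_smul] at this
        simp only [dirs_update]
        exact this
      map_update_smul' := by
        intro inst u j c a
        rw [Subsingleton.elim inst (instDecidableEqFin l)]
        refine Subtype.ext (ContinuousMap.ext fun η => ?_)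
        have h0 : eval ⟨z, hz⟩ (Function.update (dirs u) j 0) (variation P P₁ l) η = 0 := by
          simpa using eval_variation_update hO hΩ l j j.2 ⟨z, hz⟩ (dirs u) 1 0 0 η
        have := eval_variation_update hO hΩ l j j.2 ⟨z, hz⟩ (dirs u) c a 0 η
        rw [h0, add_zero, add_zero] at this
        simp only [dirs_update]
        exact this
      cont := by
        refine CkSpace.continuous_iff_der.2 fun k hk p => ?_
        simp only [der_evalCk hO _ _ _ hk]
        exact (continuous_eval hO _).comp (continuous_const.prodMk continuous_dirs) }
  else 0

section

variable (hO : RelOpen Q O) (hΩ : IsOpen (graphDomain P₂ i hQ hO')) {l : ℕ}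

theorem superpositionDeriv_apply {z : Source P₂ i hQ hO'} (hz : z ∈ graphDomain P₂ i hQ hO')
    (u : Fin l → Source P₂ i hQ hO') : superpositionDeriv hO hΩ l z u =
      DiffExpr.evalCk hO (DiffExpr.orderLE_variation l) ⟨z, hz⟩ (dirs u) := by
  rw [superpositionDeriv, dif_pos hz]
  rfl

theorem der_superpositionDeriv {z : Source P₂ i hQ hO'} (hz : z ∈ graphDomain P₂ i hQ hO')
    (u : Fin l → Source P₂ i hQ hO') {k : ℕ} (hk : (k : ℕ∞) ≤ i) (p : Fin k → P) :
    CkSpace.der k p (superpositionDeriv hO hΩ l z u) =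
      DiffExpr.eval ⟨z, hz⟩ (dirs u) ((DiffExpr.variation P P₁ l).spatialIter k p) := by
  rw [superpositionDeriv_apply hO hΩ hz, DiffExpr.der_evalCk hO _ _ _ hk]

theorem mem_superposition_iff {z : Source P₂ i hQ hO'} {g : CkSpace i Q hQ P₂} :
    g ∈ superposition i hQ hO' z ↔
      ∀ η : Q, ∃ h : ((η : P), z.2 η) ∈ O, g η = z.1 ⟨((η : P), z.2 η), h⟩ := by
  refine mem_theOnly fun a b ha hb => Subtype.ext (ContinuousMap.ext fun η => ?_)
  obtain ⟨h, ha⟩ := ha η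
  obtain ⟨_, hb⟩ := hb η
  exact ha.trans hb.symm

theorem superpositionDeriv_zero_mem {z : Source P₂ i hQ hO'} (hz : z ∈ graphDomain P₂ i hQ hO')
    (u : Fin 0 → Source P₂ i hQ hO') :
    superpositionDeriv hO hΩ 0 z u ∈ superposition i hQ hO' z := by
  rw [mem_superposition_iff]
  intro η
  refine ⟨hz η, ?_⟩
  rw [superpositionDeriv_apply hO hΩ hz]
  change DiffExpr.eval _ _ _ η = _
  rw [DiffExpr.variation, DiffExpr.eval_comp, CkSpace.der_zero]
  rfl

theorem dom_superposition (hO : RelOpen Q O) (hΩ : IsOpen (graphDomain P₂ i hQ hO')) : (superposition i hQ hO').Dom = graphDomain P₂ i hQ hO' := by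
  ext z
  refine ⟨fun h η => ?_, fun h => ?_⟩
  · obtain ⟨g, hg⟩ := Part.dom_iff_mem.1 h
    exact (mem_superposition_iff.1 hg η).1
  · exact Part.dom_iff_mem.2 ⟨_, superpositionDeriv_zero_mem hO hΩ h Fin.elim0⟩

theorem eval_eq_der_succ {z : graphDomain P₂ i hQ hO'}
    (u : Fin (l + 1) → Source P₂ i hQ hO') {k : ℕ} (hk : (k : ℕ∞) ≤ i) (p : Fin k → P) :
    DiffExpr.eval z (dirs u) (((DiffExpr.variation P P₁ l).spatialIter k p).vary l) =
      CkSpace.der k p (superpositionDeriv hO hΩ (l + 1) z.1 u) := by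
  rw [der_superpositionDeriv hO hΩ z.2 u hk, DiffExpr.variation,
    DiffExpr.eval_spatialIter_vary hO (DiffExpr.orderLE_variation l) z _ l k hk]

/-- For each d̄(p) and compact K, the mean value inequality bounds the error by the oscillation over
K of the derivative along the segment, which is small by `continuous_eval`. Commutation identifies
the limit with d̄(p) of the next variation. -/
theorem tendsto_superpositionDeriv {z : Source P₂ i hQ hO'} (hz : z ∈ graphDomain P₂ i hQ hO')
    (u : Fin (l + 1) → Source P₂ i hQ hO') :
    Tendsto (fun t : ℝ => t⁻¹ • (superpositionDeriv hO hΩ l (z + t • u (Fin.last l)) (Fin.init u)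
      - superpositionDeriv hO hΩ l z (Fin.init u))) (𝓝[≠] 0)
      (𝓝 (superpositionDeriv hO hΩ (l + 1) z u)) := by
  refine CkSpace.tendsto_iff_der.2 fun k hk p K hK ε hε => ?_
  set v := u (Fin.last l)
  set S := (DiffExpr.variation P P₁ l).spatialIter k p
  have hS : S.Below l := (DiffExpr.below_variation l).spatialIter k p
  have hcont : Continuous fun z' : graphDomain P₂ i hQ hO' =>
      DiffExpr.eval z' (dirs u) (S.vary l) :=
    (DiffExpr.continuous_eval hO _).comp (continuous_id.prodMk continuous_const)
  have hev := eventually_norm_sub_lt (x₀ := (⟨z, hz⟩ : graphDomain P₂ i hQ hO'))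
    hcont.continuousAt hK (half_pos hε)
  rw [nhds_subtype_eq_comap, eventually_comap] at hev
  have hline : Tendsto (fun t : ℝ => z + t • v) (𝓝 0) (𝓝 z) := by
    have hc : Continuous fun t : ℝ => z + t • v := by fun_prop
    simpa using hc.tendsto 0
  obtain ⟨δ, hδ, hball⟩ := Metric.eventually_nhds_iff.1
    ((hline.eventually hev).and (DiffExpr.eventually_line_mem_nhds hΩ hz v))
  have hsmall : ∀ᶠ t in 𝓝[≠] (0 : ℝ), |t| < δ := by
    refine Filter.Eventually.filter_mono nhdsWithin_le_nhds ?_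
    exact Metric.eventually_nhds_iff.2 ⟨δ, hδ, fun y hy => by simpa using hy⟩
  filter_upwards [hsmall, self_mem_nhdsWithin] with t ht ht0 η hη
  have ht0 : t ≠ 0 := ht0
  have hin : ∀ s : ℝ, |s| ≤ |t| → z + s • v ∈ graphDomain P₂ i hQ hO' := fun s hs =>
    (hball (y := s) (by simpa using hs.trans_lt ht)).2
  have hmv := norm_sub_sub_smul_le (T := t) (ε := ε / 2)
    (c := DiffExpr.eval ⟨z, hz⟩ (dirs u) (S.vary l) η)
    (fun s hs => DiffExpr.hasDerivAt_line_eval_vary hO hΩ hS (hin s hs) (dirs (Fin.init u)) η)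
    (fun s hs => by
      rw [extZero_of_mem _ (hin s hs), update_dirs_init]
      exact ((hball (y := s) (by simpa using hs.trans_lt ht)).1 ⟨_, hin s hs⟩ rfl η hη).le)
  simp only [zero_smul, add_zero] at hmv
  rw [extZero_of_mem _ (hin t le_rfl), extZero_of_mem _ hz] at hmv
  rw [map_smul, map_sub, der_superpositionDeriv hO hΩ (hin t le_rfl) _ hk,
    der_superpositionDeriv hO hΩ hz _ hk, ← eval_eq_der_succ hO hΩ (z := ⟨z, hz⟩) u hk,
    ContinuousMap.smul_apply, ContinuousMap.sub_apply]
  have hfac : ∀ a b c : P₂, t⁻¹ • (a - b) - c = t⁻¹ • (a - b - t • c) := fun a b c => by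
    rw [smul_sub t⁻¹ (a - b), inv_smul_smul₀ ht0]
  rw [hfac, norm_smul, norm_inv, Real.norm_eq_abs, inv_mul_lt_iff₀ (abs_pos.2 ht0)]
  refine hmv.trans_lt ?_
  rw [mul_comm]
  exact mul_lt_mul_of_pos_left (half_lt_self hε) (abs_pos.2 ht0)

theorem superpositionDeriv_mem (l : ℕ) : ∀ z ∈ graphDomain P₂ i hQ hO',
    ∀ u : Fin l → Source P₂ i hQ hO',
      superpositionDeriv hO hΩ l z u ∈ iterDirDeriv (superposition i hQ hO') l u z := by
  induction l with
  | zero => exact fun z hz u => superpositionDeriv_zero_mem hO hΩ hz u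
  | succ l ih =>
    intro z hz u
    have hev := eventually_line_mem hΩ hz (u (Fin.last l))
    refine mem_dirDeriv.2 ⟨_, ih z hz (Fin.init u), (hev.mono fun t ht =>
      Part.dom_iff_mem.2 ⟨_, ih _ ht (Fin.init u)⟩).frequently, fun W hW => ?_⟩
    filter_upwards [tendsto_superpositionDeriv hO hΩ hz u hW, hev] with t h1 h2 a ha
    obtain rfl := Part.mem_unique ha (ih _ h2 (Fin.init u))
    exact h1

-- U has to be chosen before ε. Continuity at zero directions gives U on which the next derivative
-- is bounded by 1 near z; as it is linear in the newest direction v, taking v in a small multiple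
-- of U makes it as small as desired.
open scoped Pointwise in
theorem superpositionDeriv_uniform {z : Source P₂ i hQ hO'} (hz : z ∈ graphDomain P₂ i hQ hO') :
    ∀ W ∈ 𝓝 (0 : CkSpace i Q hQ P₂), ∃ U ∈ 𝓝 (0 : Source P₂ i hQ hO'), ∀ ε : ℝ, 0 < ε →
      ∃ V ∈ 𝓝 (0 : Source P₂ i hQ hO'), ∀ v ∈ V, z + v ∈ graphDomain P₂ i hQ hO' ∧
        ∀ u : Fin l → Source P₂ i hQ hO', (∀ j, u j ∈ U) →
          superpositionDeriv hO hΩ l (z + v) u - superpositionDeriv hO hΩ l z u ∈ ε • W := by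
  have hadd : Tendsto (fun v : Source P₂ i hQ hO' => z + v) (𝓝 0) (𝓝 z) := by
    have hc : Continuous fun v : Source P₂ i hQ hO' => z + v := by fun_prop
    simpa using hc.tendsto 0
  refine CkSpace.nhds_zero_induction ?_ ?_ ?_ ?_
  · refine ⟨univ, univ_mem, fun ε hε => ⟨_, hadd (hΩ.mem_nhds hz), fun v hv => ⟨hv, fun u _ => ?_⟩⟩⟩
    rw [smul_set_univ₀ hε.ne']
    trivial
  · rintro A B ⟨U, hU, h⟩ hAB
    refine ⟨U, hU, fun ε hε => ?_⟩
    obtain ⟨V, hV, h⟩ := h ε hε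
    exact ⟨V, hV, fun v hv => ⟨(h v hv).1, fun u hu => smul_set_mono hAB ((h v hv).2 u hu)⟩⟩
  · rintro A B ⟨U, hU, h⟩ ⟨U', hU', h'⟩
    refine ⟨U ∩ U', inter_mem hU hU', fun ε hε => ?_⟩
    obtain ⟨V, hV, h⟩ := h ε hε
    obtain ⟨V', hV', h'⟩ := h' ε hε
    refine ⟨V ∩ V', inter_mem hV hV', fun v hv => ⟨(h v hv.1).1, fun u hu => ?_⟩⟩
    rw [smul_set_inter₀ hε.ne']
    exact ⟨(h v hv.1).2 u fun j => (hu j).1, (h' v hv.2).2 u fun j => (hu j).2⟩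
  · intro k hk p K hK ε₀ hε₀
    set S := (DiffExpr.variation P P₁ l).spatialIter k p
    have hS : S.Below l := (DiffExpr.below_variation l).spatialIter k p
    have hev := eventually_norm_sub_lt
      (x₀ := ((⟨z, hz⟩, 0) : graphDomain P₂ i hQ hO' × (ℕ → Source P₂ i hQ hO')))
      (DiffExpr.continuous_eval hO (S.vary l)).continuousAt hK one_pos
    rw [nhds_prod_eq] at hev
    obtain ⟨A, hA, N, hN, hAN⟩ := Filter.mem_prod_iff.1 hev
    rw [nhds_subtype_eq_comap, mem_comap] at hA
    obtain ⟨V₀, hV₀, hVA⟩ := hA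
    -- A neighbourhood of the zero sequence restricts only finitely many directions, so one U serves
    -- for all indices.
    rw [nhds_pi, Filter.mem_pi] at hN
    obtain ⟨I, hI, U', hU', hIU⟩ := hN
    set U := ⋂ n ∈ I, U' n
    have hU : U ∈ 𝓝 (0 : Source P₂ i hQ hO') := (biInter_mem hI).2 fun n _ => hU' n
    have hbound : ∀ z' : graphDomain P₂ i hQ hO', (z' : Source P₂ i hQ hO') ∈ V₀ →
        ∀ θ : ℕ → Source P₂ i hQ hO', (∀ n, θ n ∈ U) → ∀ η ∈ K,
          ‖DiffExpr.eval z' θ (S.vary l) η‖ ≤ 1 := by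
      intro z' hz' θ hθ η hη
      have h1 := hAN (mk_mem_prod (hVA hz')
        (hIU fun n hn => mem_iInter₂.1 (hθ n) n hn)) η hη
      have h0 := DiffExpr.eval_vary_update_zero hS ⟨z, hz⟩ 0 η
      rw [Function.update_eq_self_iff.2 (by rfl)] at h0
      simp only [h0, sub_zero] at h1
      exact h1.le
    refine ⟨U, hU, fun ε hε => ?_⟩
    -- Half of the required bound ε ε₀, leaving room for the strict inequality at the end.
    set c := ε * ε₀ / 2
    have hc : 0 < c := half_pos (mul_pos hε hε₀)
    -- A balanced neighbourhood keeps the entire segment from z to z + v in the region where the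
    -- bound and the formal calculus apply.
    have hB := balancedCore_mem_nhds_zero (𝕜 := ℝ)
      (hadd (inter_mem hV₀ (hΩ.mem_nhds hz)))
    set B := balancedCore ℝ ((fun v => z + v) ⁻¹' (V₀ ∩ graphDomain P₂ i hQ hO'))
    have hline : ∀ v ∈ B, ∀ t : ℝ, |t| ≤ 1 → z + t • v ∈ V₀ ∩ graphDomain P₂ i hQ hO' :=
      fun v hv t ht => balancedCore_subset ((fun v => z + v) ⁻¹' (V₀ ∩ graphDomain P₂ i hQ hO'))
        ((balancedCore_balanced (𝕜 := ℝ) _).smul_mem (by simpa using ht) hv)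
    refine ⟨B ∩ c • U, inter_mem hB (by simpa using (set_smul_mem_nhds_zero_iff hc.ne').2 hU),
      fun v hv => ?_⟩
    have hzv : z + v ∈ graphDomain P₂ i hQ hO' := by
      simpa using (hline v hv.1 1 (by simp)).2
    refine ⟨hzv, fun u hu => ?_⟩
    obtain ⟨v', hv', hvv⟩ := hv.2
    rw [mem_smul_set_iff_inv_smul_mem₀ hε.ne']
    intro η hη
    have hmv := norm_sub_sub_smul_le (T := 1) (ε := c) (c := (0 : P₂))
      (fun s hs => DiffExpr.hasDerivAt_line_eval_vary hO hΩ hS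
        (hline v hv.1 s (by simpa using hs)).2 (dirs u) η)
      (fun s hs => by
        have hs' := hline v hv.1 s (by simpa using hs)
        rw [extZero_of_mem _ hs'.2, sub_zero, show Function.update (dirs u) l v =
          Function.update (dirs u) l (c • v') from congrArg _ hvv.symm,
          DiffExpr.eval_vary_update_smul hS, norm_smul, Real.norm_of_nonneg hc.le]
        refine mul_le_of_le_one_right hc.le (hbound _ hs'.1 _ (fun n => ?_) η hη)
        by_cases hn : n = l
        · rw [hn, Function.update_self]
          exact hv'
        · rw [Function.update_of_ne hn, dirs]
          split_ifs
          · exact hu _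
          · exact mem_of_mem_nhds hU)
    simp only [zero_smul, one_smul, add_zero, smul_zero, sub_zero, abs_one, mul_one] at hmv
    rw [extZero_of_mem _ hzv, extZero_of_mem _ hz] at hmv
    rw [map_smul, map_sub, der_superpositionDeriv hO hΩ hzv _ hk,
      der_superpositionDeriv hO hΩ hz _ hk, ContinuousMap.smul_apply, ContinuousMap.sub_apply,
      norm_smul, norm_inv, Real.norm_of_nonneg hε.le, inv_mul_lt_iff₀ hε]
    exact hmv.trans_lt (half_lt_self (mul_pos hε hε₀))

end

/-- The superposition map is smooth, for normed spaces. -/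
theorem kellerCPi_superposition (hO : RelOpen Q O)
    (hhole : ∃ K : Set P, IsCompact K ∧ K ⊆ Q ∧ Prod.fst '' (Q ×ˢ univ \ O) ⊆ K) :
    KellerCPi (⊤ : ℕ∞) (superposition (P₂ := P₂) i hQ hO') := by
  have hΩ : IsOpen (graphDomain P₂ i hQ hO') := isOpen_graphDomain hO hhole
  rw [KellerCPi, dom_superposition hO hΩ]
  exact ⟨hΩ, superpositionDeriv hO hΩ, fun l _ => superpositionDeriv_mem hO hΩ l,
    fun l _ z hz => superpositionDeriv_uniform hO hΩ hz⟩

end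

/-! ### Norms on finite-dimensional Hausdorff spaces -/

section Normable

variable (E : Type*) [AddCommGroup E] [Module ℝ E] [T : TopologicalSpace E]
  [IsTopologicalAddGroup E] [ContinuousSMul ℝ E] [T2Space E] [FiniteDimensional ℝ E]

/-- A finite-dimensional Hausdorff space is isomorphic to a Euclidean space. -/
def coordEquiv : E ≃L[ℝ] EuclideanSpace ℝ (Fin (Module.finrank ℝ E)) :=
  ContinuousLinearEquiv.ofFinrankEq (by simp)

/-- The norm of the coordinates. -/
abbrev coordNorm : Norm E := ⟨fun x => ‖coordEquiv E x‖⟩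

theorem coordNorm_core : @NormedSpace.Core ℝ E _ _ _ (coordNorm E) :=
  letI := coordNorm E
  { norm_nonneg := fun x => norm_nonneg (coordEquiv E x)
    norm_smul := fun c x => by
      change ‖coordEquiv E (c • x)‖ = ‖c‖ * ‖coordEquiv E x‖
      rw [map_smul, norm_smul]
    norm_triangle := fun x y => by
      change ‖coordEquiv E (x + y)‖ ≤ ‖coordEquiv E x‖ + ‖coordEquiv E y‖
      rw [map_add]
      exact norm_add_le _ _
    norm_eq_zero_iff := fun x => by
      change ‖coordEquiv E x‖ = 0 ↔ x = 0
      simp }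

/-- Both topologies are induced by the coordinate map: it is a homeomorphism for the given one and
an isometry for the norm. -/
theorem coordNorm_topology :
    letI := coordNorm E
    T = (PseudoEMetricSpace.ofSeminormedSpaceCore
      (coordNorm_core E).toCore).toUniformSpace.toTopologicalSpace := by
  let _ := coordNorm E
  have h2 : Topology.IsInducing (coordEquiv E) := (coordEquiv E).toHomeomorph.isInducing
  let N : NormedAddCommGroup E := NormedAddCommGroup.ofCore (coordNorm_core E)
  let e : E ≃ₗ[ℝ] EuclideanSpace ℝ (Fin (Module.finrank ℝ E)) := (coordEquiv E).toLinearEquiv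
  have h1 : @Topology.IsInducing E _ N.toPseudoMetricSpace.toUniformSpace.toTopologicalSpace _ e :=
    (@AddMonoidHomClass.isometry_of_norm _ _ _ N.toSeminormedAddCommGroup.toSeminormedAddGroup _ _ _ e
      fun x => rfl).isUniformInducing.isInducing
  exact h2.eq_induced.trans (@Topology.IsInducing.eq_induced _ _
    N.toPseudoMetricSpace.toUniformSpace.toTopologicalSpace _ _ h1).symm

/-- A norm defining the topology of a finite-dimensional Hausdorff space. -/
abbrev normedAddCommGroupOfFiniteDimensional : NormedAddCommGroup E :=
  letI := coordNorm E
  NormedAddCommGroup.ofCoreReplaceTopology (coordNorm_core E) (coordNorm_topology E)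

/-- The normed space structure belonging to this norm. -/
abbrev normedSpaceOfFiniteDimensional :
    @NormedSpace ℝ E _ (normedAddCommGroupOfFiniteDimensional E).toSeminormedAddCommGroup :=
  letI := normedAddCommGroupOfFiniteDimensional E
  { norm_smul_le := fun c x => ((coordNorm_core E).norm_smul c x).le }

end Normable

end Superposition

end

theorem theorem3p6 {P P₁ P₂ : Type*}
    [AddCommGroup P] [Module ℝ P] [TopologicalSpace P] [IsTopologicalAddGroup P]
    [ContinuousSMul ℝ P] [LocallyConvexSpace ℝ P] [T2Space P] [FiniteDimensional ℝ P]
    [AddCommGroup P₁] [Module ℝ P₁] [TopologicalSpace P₁] [IsTopologicalAddGroup P₁]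
    [ContinuousSMul ℝ P₁] [LocallyConvexSpace ℝ P₁] [T2Space P₁] [FiniteDimensional ℝ P₁]
    [AddCommGroup P₂] [Module ℝ P₂] [TopologicalSpace P₂] [IsTopologicalAddGroup P₂]
    [ContinuousSMul ℝ P₂] [LocallyConvexSpace ℝ P₂] [T2Space P₂] [FiniteDimensional ℝ P₂]
    (i : ℕ∞) (Q : Set P) (hQ : Superposition.IsRegular Q)
    (O : Set (P × P₁)) (hO : ∃ U : Set (P × P₁), IsOpen U ∧ O = U ∩ Q ×ˢ Set.univ)
    (hhole : ∃ K : Set P, IsCompact K ∧ K ⊆ Q ∧ Prod.fst '' (Q ×ˢ Set.univ \ O) ⊆ K) :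
    Superposition.KellerCPi (⊤ : ℕ∞)
      (Superposition.superposition (P₂ := P₂) i hQ (hQ.of_relOpen hO)) := by
  -- These norms retain the given topologies definitionally, so the function spaces and the Keller
  -- class are unchanged and the normed case applies directly.
  let _ := Superposition.normedAddCommGroupOfFiniteDimensional P
  let _ := Superposition.normedSpaceOfFiniteDimensional P
  let _ := Superposition.normedAddCommGroupOfFiniteDimensional P₁
  let _ := Superposition.normedSpaceOfFiniteDimensional P₁
  let _ := Superposition.normedAddCommGroupOfFiniteDimensional P₂
  let _ := Superposition.normedSpaceOfFiniteDimensional P₂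
  exact Superposition.kellerCPi_superposition hO hhole
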